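/- **Setting.** Consider a cell-free massive MIMO network with $M$ single-antenna access points $m\in\mathcal M=\{1,\dots,M\}$ and $N$ users $k\in\mathcal N=\{1,\dots,N\}$, large-scale fading coefficients $\beta_{mk}>0$, unit-norm pilots $\varphi_k\in\mathbb C^{\tau_t}$, integers $\tau_t<\tau_c$, and constants $\rho_t,\rho_d,\rho_u,B,S_d,S_u,L,D_k,c_k,f_{k,\max}>0$. Put $$\sigma_{mk}^2=\frac{\tau_t\rho_t\beta_{mk}^2}{\sum_{\ell}\tau_t\rho_t\beta_{m\ell}|\varphi_k^H\varphi_\ell|^2+1}.$$ For amplitudes $v=(v_{mk})$, $u=(u_k)$ let $$\Upsilon_k(v)=\sqrt{\rho_d}\sum_m v_{mk}\sigma_{mk}^2,\qquad \Pi_k(v)=\rho_d\sum_{\ell\ne k}\Big(\sum_m v_{m\ell}\sigma_{m\ell}^2\tfrac{\beta_{mk}}{\beta_{m\ell}}\Big)^2|\varphi_\ell^H\varphi_k|^2+\rho_d\sum_\ell\sum_m v_{m\ell}^2\sigma_{m\ell}^2\beta_{mk}+1,$$ $$\Psi_k(u)=\sqrt{\rho_u}\,u_k\sum_m\sigma_{mk}^2,\qquad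 \Xi_k(u)=\rho_u\sum_{\ell\ne k}u_\ell^2\Big(\sum_m\sigma_{mk}^2\tfrac{\beta_{m\ell}}{\beta_{mk}}\Big)^2|\varphi_k^H\varphi_\ell|^2+\rho_u\sum_\ell u_\ell^2\sum_m\sigma_{mk}^2\beta_{m\ell}+\sum_m\sigma_{mk}^2,$$ $$R_{d,k}(v)=\tfrac{\tau_c-\tau_t}{\tau_c}B\log_2\!\Big(1+\tfrac{\Upsilon_k^2}{\Pi_k}\Big),\qquad R_{u,k}(u)=\tfrac{\tau_c-\tau_t}{\tau_c}B\log_2\!\Big(1+\tfrac{\Psi_k^2}{\Xi_k}\Big).$$ As functions of the power control coefficients $\eta=(\eta_{mk})$ and $\zeta=(\zeta_k)$ the rates $R_{d,k}(\eta)$, $R_{u,k}(\zeta)$ are obtained by putting $v_{mk}=\sqrt{\eta_{mk}}$, $u_k=\sqrt{\zeta_k}$. **Short-term subproblem.** Fix a user selection $a\in\{0,1\}^N$ with at least one $a_k=1$. Problem (P) is to minimize $t_d+t_c+t_u$ over $(\eta,f,\zeta,r_d,r_u,t_d,t_c,t_u)$ subject to: $\sum_k\sigma_{mk}^2\eta_{mk}\le1$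 and $\eta_{mk}\ge0$ for all $m,k$; $0\le\zeta_k\le1$; $\eta_{mk}=\zeta_k=0$ if $a_k=0$; $0\le f_k\le f_{k,\max}$; $0\le r_{d,k}\le R_{d,k}(\eta)$; $0\le r_{u,k}\le R_{u,k}(\zeta)$; and, for every $k$ with $a_k\neq0$, $\frac{a_kS_d}{r_{d,k}}\le t_d$, $\frac{a_kLD_kc_k}{f_k}\le t_c$, $\frac{a_kS_u}{r_{u,k}}\le t_u$ (with positive denominators). **Algorithm.** The algorithm works with $\bar x=(\tilde v,v,f,u,r_d,r_u,t_d,t_c,t_u)$. Let $\mathcal F$ be the set of all $\bar x$ satisfying the above constraints on $f$ and on the latencies, and $\tilde v_{mk}\le a_k$, $\sum_k\tilde v_{mk}\le1$, $\sigma_{mk}^2v_{mk}^2\le\tilde v_{mk}$, $v_{mk}\ge0$, $u_k^2\le a_k$, $0\le u_k\le1$, $0\le r_{d,k}\le R_{d,k}(v)$, $0\le r_{u,k}\le R_{u,k}(u)$. For $\bar x^0\in\mathcal F$, with amplitudes $v^0,u^0$, let $\widetilde{\mathcal F}(\bar x^0)$ be defined in the same way with $R_{d,k}(v)$ replaced by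 $$\widetilde R_{d,k}(v)=\tfrac{\tau_c-\tau_t}{\tau_c\log2}B\Big[\log\Big(1+\tfrac{(\Upsilon_k^0)^2}{\Pi_k^0}\Big)-\tfrac{(\Upsilon_k^0)^2}{\Pi_k^0}+2\tfrac{\Upsilon_k^0\Upsilon_k}{\Pi_k^0}-\tfrac{(\Upsilon_k^0)^2(\Upsilon_k^2+\Pi_k)}{\Pi_k^0((\Upsilon_k^0)^2+\Pi_k^0)}\Big],$$ where $\Upsilon_k^0=\Upsilon_k(v^0)$, $\Pi_k^0=\Pi_k(v^0)$, $\Upsilon_k=\Upsilon_k(v)$, $\Pi_k=\Pi_k(v)$, and with $R_{u,k}(u)$ replaced by the analogous $\widetilde R_{u,k}(u)$ formed with $\Psi_k,\Xi_k,u^0$. Starting from any $\bar x^{(0)}\in\mathcal F$, the algorithm takes as $\bar x^{(\kappa+1)}$ any minimizer of $t_d+t_c+t_u$ over $\widetilde{\mathcal F}(\bar x^{(\kappa)})$. **Proposition.** For every $\bar x\in\mathcal F$ the convex problem over $\widetilde{\mathcal F}(\bar x)$ has a minimizer. Moreover, for every infinite sequence $(\bar x^{(\kappa)})_{\kappa\ge0}$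 generated by the algorithm: 1. all iterates lie in $\mathcal F$, the sequence is bounded, and the objective values $t_d^{(\kappa)}+t_c^{(\kappa)}+t_u^{(\kappa)}$ are nonincreasing and converge; 2. every cluster point $\bar x^*$ lies in $\mathcal F$, and $(v^*,f^*,u^*,r_d^*,r_u^*,t_d^*,t_c^*,t_u^*)$ satisfies the Karush–Kuhn–Tucker (KKT) conditions of (P) written in the amplitude variables $v=\sqrt\eta$, $u=\sqrt\zeta$ (in which all functions are smooth). If, moreover, the functions of (P) are differentiable at $((v^*)^2,f^*,(u^*)^2,r_d^*,r_u^*,t_d^*,t_c^*,t_u^*)$ (squares taken entrywise), relative to the subspace $\{\eta_{mk}=\zeta_k=0 \text{ whenever } a_k=0\}$, then this point is a KKT solution of (P) in the original variables; 3. the distance of $\bar x^{(\kappa)}$ to the set of points of $\mathcal F$ that satisfy the KKT conditions of (P) in the amplitude variables tends to $0$. -/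

import Mathlib

open Filter Topology

noncomputable section

/-- A differentiable nonlinear program on a real normed space:
minimize `cost x` over the points `x` of the linear subspace `lin` (linear equality constraints)
that lie in `dom` (the open set on which the functions are meaningful) and satisfy
`con i x ≤ 0` for every `i`. -/
structure NLP (E ι : Type*) [NormedAddCommGroup E] [NormedSpace ℝ E] where
  /-- open domain of definition of the cost and of the constraint functions -/
  dom : Set E
  /-- subspace cut out by the linear equality constraints -/
  lin : Submodule ℝ E
  /-- objective function -/
  cost : E → ℝ
  /-- inequality constraints, in the form `con i x ≤ 0` -/
  con : ι → E → ℝ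

namespace NLP

variable {E ι : Type*} [NormedAddCommGroup E] [NormedSpace ℝ E]

/-- All functions of the program are differentiable at `x` relative to the subspace `lin`. -/
def DiffAt (P : NLP E ι) (x : E) : Prop :=
  DifferentiableWithinAt ℝ P.cost P.lin x ∧ ∀ i, DifferentiableWithinAt ℝ (P.con i) P.lin x

/-- The Karush-Kuhn-Tucker conditions at `x`: primal feasibility, differentiability, dual
feasibility, complementary slackness, and stationarity of the Lagrangian. The multipliers of the
linear equality constraints are free, so they are eliminated by requiring that the derivative of
the Lagrangian vanishes on the subspace `lin`. -/
def IsKKT [Fintype ι] (P : NLP E ι) (x : E) : Prop :=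
  x ∈ P.dom ∧ x ∈ P.lin ∧ (∀ i, P.con i x ≤ 0) ∧
  ∃ (c' : E →L[ℝ] ℝ) (g' : ι → E →L[ℝ] ℝ) (lam : ι → ℝ),
    HasFDerivWithinAt P.cost c' P.lin x ∧
    (∀ i, HasFDerivWithinAt (P.con i) (g' i) P.lin x) ∧
    (∀ i, 0 ≤ lam i) ∧
    (∀ i, lam i * P.con i x = 0) ∧
    ∀ d ∈ P.lin, c' d + ∑ i, lam i * g' i d = 0

end NLP

/-- The variables `(η, f, ζ, r_d, r_u, t_d, t_c, t_u)` of the short-term subproblem. The same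
space serves for the amplitude variables `(v, f, u, r_d, r_u, t_d, t_c, t_u)`. -/
abbrev ShortVars (M N : ℕ) : Type :=
  (Fin M → Fin N → ℝ) × (Fin N → ℝ) × (Fin N → ℝ) × (Fin N → ℝ) × (Fin N → ℝ) × ℝ × ℝ × ℝ

namespace ShortVars

variable {M N : ℕ}

/-- downlink power control coefficients `η` (or their amplitudes `v`) -/
def dl (x : ShortVars M N) : Fin M → Fin N → ℝ := x.1
/-- processing frequencies -/
def f (x : ShortVars M N) : Fin N → ℝ := x.2.1
/-- uplink power control coefficients `ζ` (or their amplitudes `u`) -/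
def ul (x : ShortVars M N) : Fin N → ℝ := x.2.2.1
/-- auxiliary downlink rates -/
def rd (x : ShortVars M N) : Fin N → ℝ := x.2.2.2.1
/-- auxiliary uplink rates -/
def ru (x : ShortVars M N) : Fin N → ℝ := x.2.2.2.2.1
/-- downlink transmission time -/
def td (x : ShortVars M N) : ℝ := x.2.2.2.2.2.1
/-- computation time -/
def tc (x : ShortVars M N) : ℝ := x.2.2.2.2.2.2.1
/-- uplink transmission time -/
def tu (x : ShortVars M N) : ℝ := x.2.2.2.2.2.2.2

/-- The objective: execution time of one communication round. -/
def time (x : ShortVars M N) : ℝ := x.td + x.tc + x.tu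

/-- The change of variables `η = v ^ 2`, `ζ = u ^ 2`. -/
def toPower (x : ShortVars M N) : ShortVars M N :=
  (fun m k => x.dl m k ^ 2, x.f, fun k => x.ul k ^ 2, x.rd, x.ru, x.td, x.tc, x.tu)

end ShortVars

/-- The variables `(ṽ, (v, f, u, r_d, r_u, t_d, t_c, t_u))` on which the algorithm works. -/
abbrev AlgVars (M N : ℕ) : Type := (Fin M → Fin N → ℝ) × ShortVars M N

/-- The data of a cell-free massive MIMO network with `M` access points and `N` users. -/
structure Network (M N : ℕ) where
  /-- pilot length (samples) -/
  tauT : ℕ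
  /-- coherence block length (samples) -/
  tauC : ℕ
  tauT_lt_tauC : tauT < tauC
  /-- normalized pilot sequences -/
  pilot : Fin N → EuclideanSpace ℂ (Fin tauT)
  norm_pilot : ∀ k, ‖pilot k‖ = 1
  /-- large-scale fading coefficients -/
  beta : Fin M → Fin N → ℝ
  beta_pos : ∀ m k, 0 < beta m k
  /-- normalized pilot, downlink and uplink powers -/
  rhoT : ℝ
  rhoT_pos : 0 < rhoT
  rhoD : ℝ
  rhoD_pos : 0 < rhoD
  rhoU : ℝ
  rhoU_pos : 0 < rhoU
  /-- bandwidth -/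
  B : ℝ
  B_pos : 0 < B
  /-- sizes of the global and of the local model update -/
  Sd : ℝ
  Sd_pos : 0 < Sd
  Su : ℝ
  Su_pos : 0 < Su
  /-- number of local computing iterations -/
  L : ℝ
  L_pos : 0 < L
  /-- sizes of the local data sets -/
  D : Fin N → ℝ
  D_pos : ∀ k, 0 < D k
  /-- processing cycles per data sample -/
  c : Fin N → ℝ
  c_pos : ∀ k, 0 < c k
  /-- maximal processing frequencies -/
  fmax : Fin N → ℝ
  fmax_pos : ∀ k, 0 < fmax k

namespace Network

variable {M N : ℕ} (net : Network M N)

/-- Pilot correlation `|φ_k^H φ_l|^2`. -/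
def corr (k l : Fin N) : ℝ := ‖inner ℂ (net.pilot k) (net.pilot l)‖ ^ 2

/-- Variance `σ_{mk}^2` of the MMSE channel estimate. -/
def var (m : Fin M) (k : Fin N) : ℝ :=
  net.tauT * net.rhoT * net.beta m k ^ 2 /
    (∑ l, net.tauT * net.rhoT * net.beta m l * net.corr k l + 1)

/-- Downlink rate of user `k` as a function of the power control coefficients `η`. -/
def rateD (eta : Fin M → Fin N → ℝ) (k : Fin N) : ℝ :=
  ((net.tauC : ℝ) - net.tauT) / net.tauC * net.B * Real.logb 2 (1 +
    net.rhoD * (∑ m, √(eta m k) * net.var m k) ^ 2 /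
    (net.rhoD * ∑ l ∈ Finset.univ.erase k,
        (∑ m, √(eta m l) * net.var m l * (net.beta m k / net.beta m l)) ^ 2 * net.corr l k
      + net.rhoD * ∑ l, ∑ m, eta m l * net.var m l * net.beta m k + 1))

/-- Uplink rate of user `k` as a function of the power control coefficients `ζ`. -/
def rateU (zeta : Fin N → ℝ) (k : Fin N) : ℝ :=
  ((net.tauC : ℝ) - net.tauT) / net.tauC * net.B * Real.logb 2 (1 +
    net.rhoU * zeta k * (∑ m, net.var m k) ^ 2 /
    (net.rhoU * ∑ l ∈ Finset.univ.erase k,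
        zeta l * (∑ m, net.var m k * (net.beta m l / net.beta m k)) ^ 2 * net.corr k l
      + net.rhoU * ∑ l, zeta l * ∑ m, net.var m k * net.beta m l + ∑ m, net.var m k))

/-- Downlink signal amplitude `Υ_k(v)`. -/
def Ups (v : Fin M → Fin N → ℝ) (k : Fin N) : ℝ :=
  √net.rhoD * ∑ m, v m k * net.var m k

/-- Downlink interference plus noise `Π_k(v)`. -/
def Pii (v : Fin M → Fin N → ℝ) (k : Fin N) : ℝ :=
  net.rhoD * ∑ l ∈ Finset.univ.erase k,
      (∑ m, v m l * net.var m l * (net.beta m k / net.beta m l)) ^ 2 * net.corr l k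
    + net.rhoD * ∑ l, ∑ m, v m l ^ 2 * net.var m l * net.beta m k + 1

/-- Uplink signal amplitude `Ψ_k(u)`. -/
def Psi (u : Fin N → ℝ) (k : Fin N) : ℝ :=
  √net.rhoU * u k * ∑ m, net.var m k

/-- Uplink interference plus noise `Ξ_k(u)`. -/
def Xii (u : Fin N → ℝ) (k : Fin N) : ℝ :=
  net.rhoU * ∑ l ∈ Finset.univ.erase k,
      u l ^ 2 * (∑ m, net.var m k * (net.beta m l / net.beta m k)) ^ 2 * net.corr k l
    + net.rhoU * ∑ l, u l ^ 2 * ∑ m, net.var m k * net.beta m l + ∑ m, net.var m k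

/-- Downlink rate as a function of the amplitudes `v`. -/
def rateDAmp (v : Fin M → Fin N → ℝ) (k : Fin N) : ℝ :=
  ((net.tauC : ℝ) - net.tauT) / net.tauC * net.B *
    Real.logb 2 (1 + net.Ups v k ^ 2 / net.Pii v k)

/-- Uplink rate as a function of the amplitudes `u`. -/
def rateUAmp (u : Fin N → ℝ) (k : Fin N) : ℝ :=
  ((net.tauC : ℝ) - net.tauT) / net.tauC * net.B *
    Real.logb 2 (1 + net.Psi u k ^ 2 / net.Xii u k)

/-- The bracket of the concave lower bounds: the minorant at `(s, q)`, anchored at `(s0, q0)`, of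
`log (1 + s ^ 2 / q)`. -/
def lowerLog (s0 q0 s q : ℝ) : ℝ :=
  Real.log (1 + s0 ^ 2 / q0) - s0 ^ 2 / q0 + 2 * (s0 * s / q0)
    - s0 ^ 2 * (s ^ 2 + q) / (q0 * (s0 ^ 2 + q0))

/-- Concave lower bound of the downlink rate, built at the amplitudes `v0`. -/
def rateDLow (v0 v : Fin M → Fin N → ℝ) (k : Fin N) : ℝ :=
  ((net.tauC : ℝ) - net.tauT) / (net.tauC * Real.log 2) * net.B *
    lowerLog (net.Ups v0 k) (net.Pii v0 k) (net.Ups v k) (net.Pii v k)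

/-- Concave lower bound of the uplink rate, built at the amplitudes `u0`. -/
def rateULow (u0 u : Fin N → ℝ) (k : Fin N) : ℝ :=
  ((net.tauC : ℝ) - net.tauT) / (net.tauC * Real.log 2) * net.B *
    lowerLog (net.Psi u0 k) (net.Xii u0 k) (net.Psi u k) (net.Xii u k)

/-- The points at which the quotients in the latency constraints of the selected users are
defined (the denominators are nonnegative by the other constraints, so nonzero means positive). -/
def latencyDom (a : Fin N → ℝ) : Set (ShortVars M N) :=
  {x | ∀ k, a k ≠ 0 → 0 < x.rd k ∧ 0 < x.f k ∧ 0 < x.ru k}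

/-- No power for the users that are not selected. -/
def noPower (a : Fin N → ℝ) : Submodule ℝ (ShortVars M N) where
  carrier := {x | ∀ k, a k = 0 → (∀ m, x.dl m k = 0) ∧ x.ul k = 0}
  zero_mem' := fun _ _ => ⟨fun _ => rfl, rfl⟩
  add_mem' := by
    intro x y hx hy k hk
    have h1 := hx k hk
    have h2 := hy k hk
    simp only [ShortVars.dl, ShortVars.ul] at h1 h2 ⊢
    refine ⟨fun m => ?_, ?_⟩
    · simp [h1.1 m, h2.1 m]
    · simp [h1.2, h2.2]
  smul_mem' := by
    intro t x hx k hk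
    have h1 := hx k hk
    simp only [ShortVars.dl, ShortVars.ul] at h1 ⊢
    refine ⟨fun m => ?_, ?_⟩
    · simp [h1.1 m]
    · simp [h1.2]

/-- Index type of the inequality constraints of the short-term subproblem, in the order in which
they are listed in `shortTerm`. -/
abbrev ConIdx (M N : ℕ) : Type :=
  Fin M ⊕ (Fin M × Fin N) ⊕ Fin N ⊕ Fin N ⊕ Fin N ⊕ Fin N ⊕ Fin N ⊕ Fin N ⊕
    Fin N ⊕ Fin N ⊕ Fin N ⊕ Fin N ⊕ Fin N

/-- The short-term subproblem for the selection `a`, in a system of coordinates for the powers: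
`p` maps a coordinate to the power that it stands for, and `Rd`, `Ru` are the rates written in
these coordinates. -/
def shortTerm (a : Fin N → ℝ) (p : ℝ → ℝ) (Rd : (Fin M → Fin N → ℝ) → Fin N → ℝ)
    (Ru : (Fin N → ℝ) → Fin N → ℝ) : NLP (ShortVars M N) (ConIdx M N) where
  dom := latencyDom a
  lin := noPower a
  cost := ShortVars.time
  con :=
    -- power constraint of each access point
    Sum.elim (fun m x => ∑ k, net.var m k * p (x.dl m k) - 1) <|
    -- nonnegative downlink powers
    Sum.elim (fun mk x => - x.dl mk.1 mk.2) <|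
    -- power constraint of each user
    Sum.elim (fun k x => p (x.ul k) - 1) <|
    -- nonnegative uplink powers
    Sum.elim (fun k x => - x.ul k) <|
    -- range of the processing frequencies
    Sum.elim (fun k x => x.f k - net.fmax k) <|
    Sum.elim (fun k x => - x.f k) <|
    -- range of the auxiliary rates
    Sum.elim (fun k x => - x.rd k) <|
    Sum.elim (fun k x => - x.ru k) <|
    Sum.elim (fun k x => x.rd k - Rd x.dl k) <|
    Sum.elim (fun k x => x.ru k - Ru x.ul k) <|
    -- latency constraints, imposed on the selected users only
    Sum.elim (fun k x => if a k = 0 then 0 else a k * net.Sd / x.rd k - x.td) <|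
    Sum.elim (fun k x => if a k = 0 then 0 else
      a k * net.L * net.D k * net.c k / x.f k - x.tc) <|
    fun k x => if a k = 0 then 0 else a k * net.Su / x.ru k - x.tu

/-- The short-term subproblem in its original variables `(η, f, ζ, r_d, r_u, t_d, t_c, t_u)`. -/
def shortP (a : Fin N → ℝ) : NLP (ShortVars M N) (ConIdx M N) :=
  net.shortTerm a (fun y => y) net.rateD net.rateU

/-- The short-term subproblem after the change of variables `v = √η`, `u = √ζ`. -/
def shortPAmp (a : Fin N → ℝ) : NLP (ShortVars M N) (ConIdx M N) :=
  net.shortTerm a (fun y => y ^ 2) net.rateDAmp net.rateUAmp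

/-- Feasible set, in the variables of the algorithm, for given rate functions. -/
def feasSet (a : Fin N → ℝ) (Rd : (Fin M → Fin N → ℝ) → Fin N → ℝ)
    (Ru : (Fin N → ℝ) → Fin N → ℝ) : Set (AlgVars M N) :=
  {w | (∀ k, 0 ≤ w.2.f k ∧ w.2.f k ≤ net.fmax k) ∧
    (∀ k, a k ≠ 0 → 0 < w.2.rd k ∧ a k * net.Sd / w.2.rd k ≤ w.2.td) ∧
    (∀ k, a k ≠ 0 → 0 < w.2.f k ∧ a k * net.L * net.D k * net.c k / w.2.f k ≤ w.2.tc) ∧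
    (∀ k, a k ≠ 0 → 0 < w.2.ru k ∧ a k * net.Su / w.2.ru k ≤ w.2.tu) ∧
    (∀ m k, w.1 m k ≤ a k) ∧
    (∀ m, ∑ k, w.1 m k ≤ 1) ∧
    (∀ m k, net.var m k * w.2.dl m k ^ 2 ≤ w.1 m k) ∧
    (∀ m k, 0 ≤ w.2.dl m k) ∧
    (∀ k, w.2.ul k ^ 2 ≤ a k) ∧
    (∀ k, 0 ≤ w.2.ul k ∧ w.2.ul k ≤ 1) ∧
    (∀ k, 0 ≤ w.2.rd k ∧ w.2.rd k ≤ Rd w.2.dl k) ∧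
    (∀ k, 0 ≤ w.2.ru k ∧ w.2.ru k ≤ Ru w.2.ul k)}

/-- The set from which the starting point is taken: true rates. -/
def feasible (a : Fin N → ℝ) : Set (AlgVars M N) :=
  net.feasSet a net.rateDAmp net.rateUAmp

/-- Feasible set of the convex inner approximation built at the point `w0`. -/
def approxFeasible (a : Fin N → ℝ) (w0 : AlgVars M N) : Set (AlgVars M N) :=
  net.feasSet a (net.rateDLow w0.2.dl) (net.rateULow w0.2.ul)

/-- `w` is an optimal solution of the convex inner approximation built at `w0`. -/
def IsStep (a : Fin N → ℝ) (w0 w : AlgVars M N) : Prop :=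
  w ∈ net.approxFeasible a w0 ∧ ∀ y ∈ net.approxFeasible a w0, w.2.time ≤ y.2.time

/-- A sequence of iterates of the successive convex approximation algorithm. -/
def IsRun (a : Fin N → ℝ) (w : ℕ → AlgVars M N) : Prop :=
  w 0 ∈ net.feasible a ∧ ∀ n, net.IsStep a (w n) (w (n + 1))

end Network

end

/-! ### Lagrange multipliers from separation, and derivatives along curves. -/

/-- Motzkin-type alternative in the form of the multiplier rule: if no direction of the subspace
strictly decreases the cost and all the constraints, and some direction strictly decreases all the
constraints, then there are Lagrange multipliers. -/
theorem exists_multipliers {E J : Type*} [AddCommGroup E] [Module ℝ E] [Fintype J]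
    (lin : Submodule ℝ E) (c : E →ₗ[ℝ] ℝ) (g : J → E →ₗ[ℝ] ℝ)
    (hno : ∀ d ∈ lin, (∀ j, g j d < 0) → 0 ≤ c d)
    (hreg : ∃ d ∈ lin, ∀ j, g j d < 0) :
    ∃ lam : J → ℝ, (∀ j, 0 ≤ lam j) ∧ ∀ d ∈ lin, c d + ∑ j, lam j * g j d = 0 := by
  classical
  -- The coordinate `none` carries the cost and `some j` the constraints. By `hno` the image of the
  -- subspace misses the open negative orthant, so a hyperplane separates them.
  let A : E →ₗ[ℝ] (Option J → ℝ) := LinearMap.pi fun o => o.elim c g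
  let U : Set (Option J → ℝ) := Set.univ.pi fun _ => Set.Iio 0
  have hUo : IsOpen U := isOpen_set_pi Set.finite_univ fun _ _ => isOpen_Iio
  have hUc : Convex ℝ U := convex_pi fun _ _ => convex_Iio 0
  have hdisj : Disjoint U (lin.map A : Set (Option J → ℝ)) := by
    rw [Set.disjoint_left]
    rintro y hy ⟨d, hd, rfl⟩
    have h0 : c d < 0 := hy none trivial
    exact absurd (hno d hd fun j => hy (some j) trivial) (not_le.2 h0)
  obtain ⟨F, u, hFU, hFC⟩ := geometric_hahn_banach_open hUc hUo (lin.map A).convex hdisj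
  have hu : u ≤ 0 := by simpa using hFC 0 (Submodule.zero_mem _)
  have hF0 : ∀ y ∈ lin.map A, F y = 0 := by
    intro y hy
    by_contra hne
    -- A functional bounded below on a subspace vanishes there: this multiple of `y` would have the
    -- value `u - 1`.
    have := hFC (((u - 1) / F y) • y) (Submodule.smul_mem _ _ hy)
    rw [map_smul, smul_eq_mul, div_mul_cancel₀ _ hne] at this
    linarith
  let μ : Option J → ℝ := fun o => F (Pi.single o 1)
  have hFμ : ∀ y, F y = ∑ o, μ o * y o := by
    intro y
    conv_lhs => rw [pi_eq_sum_univ' y]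
    simp [μ, map_sum, mul_comm]
  have hneg : ∀ y ∈ U, F y < 0 := fun y hy => (hFU y hy).trans_le hu
  have hμ : ∀ o, 0 ≤ μ o := by
    intro o
    -- The negative basis vector is only on the boundary of the orthant, so it is approached from
    -- inside.
    have hlim : Tendsto (fun ε : ℝ => F (-Pi.single o 1 - ε • fun _ => (1 : ℝ))) (𝓝[>] 0)
        (𝓝 (F (-Pi.single o 1 - (0 : ℝ) • fun _ => (1 : ℝ)))) := by
      apply Tendsto.mono_left _ nhdsWithin_le_nhds
      apply Continuous.tendsto
      fun_prop
    have hle := le_of_tendsto hlim (b := 0) (by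
      filter_upwards [self_mem_nhdsWithin] with ε hε
      refine (hneg _ fun i _ => ?_).le
      have hε : 0 < ε := hε
      by_cases h : i = o
      · subst h; simp; linarith
      · simp [h, hε])
    simp only [zero_smul, sub_zero, map_neg] at hle
    simpa [μ] using hle
  have hst : ∀ d ∈ lin, μ none * c d + ∑ j, μ (some j) * g j d = 0 := by
    intro d hd
    have := hF0 (A d) ⟨d, hd, rfl⟩
    rwa [hFμ, Fintype.sum_option] at this
  -- With no weight on the cost, the regular direction makes a sum of nonpositive terms vanish. All
  -- weights are then zero, although `F` is negative on the orthant.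
  have hμ0 : μ none ≠ 0 := by
    intro h0
    obtain ⟨d, hd, hgd⟩ := hreg
    have h1 := hst d hd
    rw [h0, zero_mul, zero_add, Finset.sum_eq_zero_iff_of_nonpos
      (fun j _ => mul_nonpos_of_nonneg_of_nonpos (hμ _) (hgd j).le)] at h1
    have h2 : ∀ o, μ o = 0 := by
      rintro (_ | j)
      · exact h0
      · exact (mul_eq_zero.1 (h1 j (Finset.mem_univ j))).resolve_right (hgd j).ne
    have h3 := hneg (fun _ => -1) fun _ _ => by simp
    rw [hFμ] at h3
    simp [h2] at h3
  have hpos : 0 < μ none := (hμ none).lt_of_ne' hμ0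
  refine ⟨fun j => μ (some j) / μ none, fun j => div_nonneg (hμ _) hpos.le, fun d hd => ?_⟩
  have := hst d hd
  have h4 : ∑ j, μ (some j) / μ none * g j d = (∑ j, μ (some j) * g j d) / μ none := by
    rw [Finset.sum_div]
    exact Finset.sum_congr rfl fun j _ => by ring
  rw [h4]
  field_simp
  linarith

/-- Chain rule along a curve that stays in the set on which the derivative is taken. -/
theorem HasFDerivWithinAt.hasDerivAt_curve {E : Type*} [NormedAddCommGroup E] [NormedSpace ℝ E]
    {S : Set E} {f : E → ℝ} {f' : E →L[ℝ] ℝ} {γ : ℝ → E} {x d : E}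
    (hf : HasFDerivWithinAt f f' S x) (hγ : HasDerivAt γ d 0) (h0 : γ 0 = x)
    (hm : ∀ t, γ t ∈ S) : HasDerivAt (fun t => f (γ t)) (f' d) 0 := by
  rw [← hasDerivWithinAt_univ] at hγ ⊢
  exact HasFDerivWithinAt.comp_hasDerivWithinAt (t := S) (0 : ℝ) (by rwa [h0]) hγ fun t _ => hm t

/-- If two functions touch at `x` and one majorizes the other, they have the same derivative. -/
theorem HasFDerivAt.of_majorant {E : Type*} [NormedAddCommGroup E] [NormedSpace ℝ E]
    {f h : E → ℝ} {f' : E →L[ℝ] ℝ} {x : E} (hf : HasFDerivAt f f' x) (hh : DifferentiableAt ℝ h x)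
    (hle : ∀ y, f y ≤ h y) (heq : f x = h x) : HasFDerivAt h f' x := by
  have hmin : IsLocalMin (h - f) x :=
    Filter.Eventually.of_forall fun y => by simpa [heq] using hle y
  have h0 := hmin.hasFDerivAt_eq_zero (hh.hasFDerivAt.sub hf)
  rw [← sub_eq_zero.1 h0]
  exact hh.hasFDerivAt

theorem hasDerivAt_line {E : Type*} [NormedAddCommGroup E] [NormedSpace ℝ E] (x d : E) :
    HasDerivAt (fun t : ℝ => x + t • d) d 0 := by
  simpa using ((hasDerivAt_id (0 : ℝ)).smul_const d).const_add x

/-- The derivative in a direction is the derivative along the line. -/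
theorem HasFDerivAt.hasDerivAt_line {E : Type*} [NormedAddCommGroup E] [NormedSpace ℝ E]
    {f : E → ℝ} {f' : E →L[ℝ] ℝ} {x : E} (hf : HasFDerivAt f f' x) (d : E) :
    HasDerivAt (fun t : ℝ => f (x + t • d)) (f' d) 0 := by
  exact HasFDerivAt.comp_hasDerivAt (0 : ℝ) (by simpa using hf) (_root_.hasDerivAt_line x d)

/-! ### Surrogate rates: minorization, tangency and regularity. -/

namespace Network

/-- Two tangent bounds are combined. First log r ≤ r - 1, for r the quotient of the two arguments of
the logarithm. Then the convex function s²/y with y = s² + q lies above its tangent plane at the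
anchor, the gap being the square in `h2`. -/
theorem lowerLog_le {s0 q0 s q : ℝ} (hq0 : 0 < q0) (hq : 0 < q) :
    lowerLog s0 q0 s q ≤ Real.log (1 + s ^ 2 / q) := by
  have hy0 : 0 < s0 ^ 2 + q0 := by positivity
  have hy : 0 < s ^ 2 + q := by positivity
  have hX0 : 1 + s0 ^ 2 / q0 = (s0 ^ 2 + q0) / q0 := by field_simp; ring
  have hX : 1 + s ^ 2 / q = (s ^ 2 + q) / q := by field_simp; ring
  have hr : 0 < (s0 ^ 2 + q0) / q0 / ((s ^ 2 + q) / q) := by positivity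
  have h1 := Real.log_le_sub_one_of_pos hr
  rw [Real.log_div (by positivity) (by positivity)] at h1
  unfold lowerLog
  rw [hX0, hX]
  have h2 : 0 ≤ (s0 ^ 2 + q0) / (q0 * (s ^ 2 + q)) *
      (s - s0 * (s ^ 2 + q) / (s0 ^ 2 + q0)) ^ 2 := by positivity
  have h3 : (s0 ^ 2 + q0) / q0 / ((s ^ 2 + q) / q) - 1 =
      s0 ^ 2 / q0 - 2 * (s0 * s / q0) + s0 ^ 2 * (s ^ 2 + q) / (q0 * (s0 ^ 2 + q0))
      - (s0 ^ 2 + q0) / (q0 * (s ^ 2 + q)) * (s - s0 * (s ^ 2 + q) / (s0 ^ 2 + q0)) ^ 2 := by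
    field_simp
    ring
  linarith

theorem lowerLog_self {s q : ℝ} (hq : 0 < q) :
    lowerLog s q s q = Real.log (1 + s ^ 2 / q) := by
  have hy : 0 < s ^ 2 + q := by positivity
  unfold lowerLog
  field_simp
  ring

theorem lowerLog_zero {q0 s q : ℝ} : lowerLog 0 q0 s q = 0 := by
  simp [lowerLog]

theorem lowerLog_continuousAt {X : Type*} [TopologicalSpace X] {s0 q0 : X → ℝ} {x : X} {s q : ℝ}
    (hs : ContinuousAt s0 x) (hq : ContinuousAt q0 x) (hpos : 0 < q0 x) :
    ContinuousAt (fun y => lowerLog (s0 y) (q0 y) s q) x := by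
  have h1 : q0 x ≠ 0 := hpos.ne'
  have h2 : (1 + s0 x ^ 2 / q0 x) ≠ 0 := by positivity
  have h3 : q0 x * (s0 x ^ 2 + q0 x) ≠ 0 := by positivity
  unfold lowerLog
  fun_prop (disch := assumption)

variable {M N : ℕ} (net : Network M N)

theorem corr_nonneg (k l : Fin N) : 0 ≤ net.corr k l := by unfold corr; positivity

/-- A space of dimension zero contains no unit vector, so one pilot is enough. -/
theorem tauT_pos (k : Fin N) : 0 < net.tauT := by
  rcases Nat.eq_zero_or_pos net.tauT with h | h
  · have h1 := net.norm_pilot k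
    have : IsEmpty (Fin net.tauT) := by rw [h]; infer_instance
    rw [Subsingleton.elim (net.pilot k) 0] at h1
    simp at h1
  · exact h

theorem var_pos (m : Fin M) (k : Fin N) : 0 < net.var m k := by
  have h1 : (0 : ℝ) < net.tauT := by exact_mod_cast net.tauT_pos k
  have h2 := net.rhoT_pos
  have h3 := net.beta_pos
  have h4 : 0 ≤ ∑ l, net.tauT * net.rhoT * net.beta m l * net.corr k l :=
    Finset.sum_nonneg fun l _ => by
      have := net.corr_nonneg k l
      have := (h3 m l).le
      positivity
  have := h3 m k
  unfold var
  positivity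

theorem Pii_pos (v : Fin M → Fin N → ℝ) (k : Fin N) : 0 < net.Pii v k := by
  have h1 := net.rhoD_pos
  have h2 : 0 ≤ ∑ l ∈ Finset.univ.erase k,
      (∑ m, v m l * net.var m l * (net.beta m k / net.beta m l)) ^ 2 * net.corr l k :=
    Finset.sum_nonneg fun l _ => mul_nonneg (sq_nonneg _) (net.corr_nonneg _ _)
  have h3 : 0 ≤ ∑ l, ∑ m, v m l ^ 2 * net.var m l * net.beta m k :=
    Finset.sum_nonneg fun l _ => Finset.sum_nonneg fun m _ =>
      mul_nonneg (mul_nonneg (sq_nonneg _) (net.var_pos _ _).le) (net.beta_pos _ _).le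
  unfold Pii
  positivity

/-- The uplink noise term is a sum over the access points, which is empty for `M = 0`. The downlink
has the constant 1 instead. -/
theorem Xii_pos (hM : 0 < M) (u : Fin N → ℝ) (k : Fin N) : 0 < net.Xii u k := by
  have h1 := net.rhoU_pos
  have h2 : 0 ≤ ∑ l ∈ Finset.univ.erase k,
      u l ^ 2 * (∑ m, net.var m k * (net.beta m l / net.beta m k)) ^ 2 * net.corr k l :=
    Finset.sum_nonneg fun l _ => mul_nonneg (by positivity) (net.corr_nonneg _ _)
  have h3 : 0 ≤ ∑ l, u l ^ 2 * ∑ m, net.var m k * net.beta m l :=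
    Finset.sum_nonneg fun l _ => mul_nonneg (sq_nonneg _) (Finset.sum_nonneg fun m _ =>
      mul_nonneg (net.var_pos _ _).le (net.beta_pos _ _).le)
  have : Nonempty (Fin M) := ⟨⟨0, hM⟩⟩
  have h4 : 0 < ∑ m, net.var m k :=
    Finset.sum_pos (fun m _ => net.var_pos m k) Finset.univ_nonempty
  unfold Xii
  positivity

theorem prefactor_pos : 0 < ((net.tauC : ℝ) - net.tauT) / net.tauC * net.B := by
  have h : (net.tauT : ℝ) < net.tauC := by exact_mod_cast net.tauT_lt_tauC
  have h0 : (0 : ℝ) ≤ net.tauT := Nat.cast_nonneg _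
  have := net.B_pos
  exact mul_pos (div_pos (by linarith) (by linarith)) this

/-- The bandwidth factor in front of natural logarithms. -/
noncomputable def scale : ℝ := ((net.tauC : ℝ) - net.tauT) / net.tauC * net.B / Real.log 2

theorem scale_pos : 0 < net.scale := div_pos net.prefactor_pos (Real.log_pos one_lt_two)

theorem rateDAmp_eq (v : Fin M → Fin N → ℝ) (k : Fin N) :
    net.rateDAmp v k = net.scale * Real.log (1 + net.Ups v k ^ 2 / net.Pii v k) := by
  unfold rateDAmp scale Real.logb
  ring

theorem rateUAmp_eq (u : Fin N → ℝ) (k : Fin N) :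
    net.rateUAmp u k = net.scale * Real.log (1 + net.Psi u k ^ 2 / net.Xii u k) := by
  unfold rateUAmp scale Real.logb
  ring

theorem rateDLow_eq (v0 v : Fin M → Fin N → ℝ) (k : Fin N) :
    net.rateDLow v0 v k =
      net.scale * lowerLog (net.Ups v0 k) (net.Pii v0 k) (net.Ups v k) (net.Pii v k) := by
  unfold rateDLow scale
  have : Real.log 2 ≠ 0 := (Real.log_pos one_lt_two).ne'
  field_simp

theorem rateULow_eq (u0 u : Fin N → ℝ) (k : Fin N) :
    net.rateULow u0 u k =
      net.scale * lowerLog (net.Psi u0 k) (net.Xii u0 k) (net.Psi u k) (net.Xii u k) := by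
  unfold rateULow scale
  have : Real.log 2 ≠ 0 := (Real.log_pos one_lt_two).ne'
  field_simp

theorem rateDLow_le (v0 v : Fin M → Fin N → ℝ) (k : Fin N) :
    net.rateDLow v0 v k ≤ net.rateDAmp v k := by
  rw [rateDLow_eq, rateDAmp_eq]
  exact mul_le_mul_of_nonneg_left (lowerLog_le (net.Pii_pos _ _) (net.Pii_pos _ _))
    net.scale_pos.le

theorem rateULow_le (hM : 0 < M) (u0 u : Fin N → ℝ) (k : Fin N) :
    net.rateULow u0 u k ≤ net.rateUAmp u k := by
  rw [rateULow_eq, rateUAmp_eq]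
  exact mul_le_mul_of_nonneg_left (lowerLog_le (net.Xii_pos hM _ _) (net.Xii_pos hM _ _))
    net.scale_pos.le

theorem rateDLow_self (v : Fin M → Fin N → ℝ) (k : Fin N) :
    net.rateDLow v v k = net.rateDAmp v k := by
  rw [rateDLow_eq, rateDAmp_eq, lowerLog_self (net.Pii_pos _ _)]

theorem rateULow_self (hM : 0 < M) (u : Fin N → ℝ) (k : Fin N) :
    net.rateULow u u k = net.rateUAmp u k := by
  rw [rateULow_eq, rateUAmp_eq, lowerLog_self (net.Xii_pos hM _ _)]

theorem differentiable_Ups (k : Fin N) : Differentiable ℝ fun v => net.Ups v k := by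
  unfold Ups
  fun_prop

theorem differentiable_Pii (k : Fin N) : Differentiable ℝ fun v => net.Pii v k := by
  unfold Pii
  fun_prop

theorem differentiable_Psi (k : Fin N) : Differentiable ℝ fun u => net.Psi u k := by
  unfold Psi
  fun_prop

theorem differentiable_Xii (k : Fin N) : Differentiable ℝ fun u => net.Xii u k := by
  unfold Xii
  fun_prop

theorem differentiable_rateDAmp (k : Fin N) : Differentiable ℝ fun v => net.rateDAmp v k := by
  intro v
  simp only [rateDAmp_eq]
  have hq := net.Pii_pos v k
  have h1 := net.differentiable_Ups k v
  have h2 := net.differentiable_Pii k v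
  have h3 : net.Pii v k ≠ 0 := hq.ne'
  have h4 : 1 + net.Ups v k ^ 2 / net.Pii v k ≠ 0 := by positivity
  fun_prop (disch := assumption)

theorem differentiable_rateUAmp (hM : 0 < M) (k : Fin N) :
    Differentiable ℝ fun u => net.rateUAmp u k := by
  intro u
  simp only [rateUAmp_eq]
  have hq := net.Xii_pos hM u k
  have h1 := net.differentiable_Psi k u
  have h2 := net.differentiable_Xii k u
  have h3 : net.Xii u k ≠ 0 := hq.ne'
  have h4 : 1 + net.Psi u k ^ 2 / net.Xii u k ≠ 0 := by positivity
  fun_prop (disch := assumption)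

theorem differentiable_rateDLow (v0 : Fin M → Fin N → ℝ) (k : Fin N) :
    Differentiable ℝ fun v => net.rateDLow v0 v k := by
  have h1 := net.differentiable_Ups k
  have h2 := net.differentiable_Pii k
  simp only [rateDLow_eq, lowerLog, div_eq_mul_inv]
  fun_prop

theorem differentiable_rateULow (u0 : Fin N → ℝ) (k : Fin N) :
    Differentiable ℝ fun u => net.rateULow u0 u k := by
  have h1 := net.differentiable_Psi k
  have h2 := net.differentiable_Xii k
  simp only [rateULow_eq, lowerLog, div_eq_mul_inv]
  fun_prop

/-- Here the test point is fixed and the anchor moves; this transfers strict feasibility from a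
cluster point to nearby iterates. -/
theorem continuous_rateDLow_anchor (v : Fin M → Fin N → ℝ) (k : Fin N) :
    Continuous fun v0 => net.rateDLow v0 v k := by
  simp only [rateDLow_eq]
  exact continuous_const.mul <| continuous_iff_continuousAt.2 fun v0 =>
    lowerLog_continuousAt (net.differentiable_Ups k v0).continuousAt
      (net.differentiable_Pii k v0).continuousAt (net.Pii_pos v0 k)

theorem continuous_rateULow_anchor (hM : 0 < M) (u : Fin N → ℝ) (k : Fin N) :
    Continuous fun u0 => net.rateULow u0 u k := by
  simp only [rateULow_eq]
  exact continuous_const.mul <| continuous_iff_continuousAt.2 fun u0 =>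
    lowerLog_continuousAt (net.differentiable_Psi k u0).continuousAt
      (net.differentiable_Xii k u0).continuousAt (net.Xii_pos hM u0 k)

/-- An anchor without signal kills every term of the surrogate. For a user that is not selected, the
auxiliary rate 0 is therefore always admissible. -/
theorem rateDLow_eq_zero {v0 : Fin M → Fin N → ℝ} {k : Fin N} (h : ∀ m, v0 m k = 0)
    (v : Fin M → Fin N → ℝ) : net.rateDLow v0 v k = 0 := by
  have : net.Ups v0 k = 0 := by simp [Ups, h]
  rw [rateDLow_eq, this, lowerLog_zero, mul_zero]

theorem rateULow_eq_zero {u0 : Fin N → ℝ} {k : Fin N} (h : u0 k = 0)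
    (u : Fin N → ℝ) : net.rateULow u0 u k = 0 := by
  have : net.Psi u0 k = 0 := by simp [Psi, h]
  rw [rateULow_eq, this, lowerLog_zero, mul_zero]

end Network

/-! ### Feasible sets: closedness, compactness, existence of steps and descent. -/

namespace Network

variable {M N : ℕ} (net : Network M N)

/-- The inequality constraints of the short-term subproblem that concern an access point or a
selected user. -/
def Selected (a : Fin N → ℝ) : ConIdx M N → Prop :=
  Sum.elim (fun _ => True) <| Sum.elim (fun mk => a mk.2 ≠ 0) <|
  Sum.elim (fun k => a k ≠ 0) <| Sum.elim (fun k => a k ≠ 0) <|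
  Sum.elim (fun k => a k ≠ 0) <| Sum.elim (fun k => a k ≠ 0) <|
  Sum.elim (fun k => a k ≠ 0) <| Sum.elim (fun k => a k ≠ 0) <|
  Sum.elim (fun k => a k ≠ 0) <| Sum.elim (fun k => a k ≠ 0) <|
  Sum.elim (fun k => a k ≠ 0) <| Sum.elim (fun k => a k ≠ 0) fun k => a k ≠ 0

variable {a : Fin N → ℝ} {Rd : (Fin M → Fin N → ℝ) → Fin N → ℝ} {Ru : (Fin N → ℝ) → Fin N → ℝ}

theorem feasSet_mono {Rd' : (Fin M → Fin N → ℝ) → Fin N → ℝ} {Ru' : (Fin N → ℝ) → Fin N → ℝ}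
    (hd : ∀ v k, Rd v k ≤ Rd' v k) (hu : ∀ u k, Ru u k ≤ Ru' u k) :
    net.feasSet a Rd Ru ⊆ net.feasSet a Rd' Ru' := by
  rintro w ⟨h1, h2, h3, h4, h5, h6, h7, h8, h9, h10, h11, h12⟩
  exact ⟨h1, h2, h3, h4, h5, h6, h7, h8, h9, h10, fun k => ⟨(h11 k).1, (h11 k).2.trans (hd _ k)⟩,
    fun k => ⟨(h12 k).1, (h12 k).2.trans (hu _ k)⟩⟩

theorem mem_latencyDom_of_mem_feasSet {w : AlgVars M N} (hw : w ∈ net.feasSet a Rd Ru) :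
    w.2 ∈ latencyDom a :=
  fun k hk => ⟨(hw.2.1 k hk).1, (hw.2.2.1 k hk).1, (hw.2.2.2.1 k hk).1⟩

theorem mem_noPower_of_mem_feasSet {w : AlgVars M N} (hw : w ∈ net.feasSet a Rd Ru) :
    w.2 ∈ noPower a := by
  obtain ⟨-, -, -, -, h5, -, h7, -, h9, -⟩ := hw
  refine fun k hk => ⟨fun m => ?_, ?_⟩
  · have h1 := (h7 m k).trans (h5 m k)
    have h2 := net.var_pos m k
    rw [hk] at h1
    by_contra hne
    have : 0 < w.2.dl m k ^ 2 := by positivity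
    nlinarith
  · have h1 := h9 k
    rw [hk] at h1
    exact pow_eq_zero_iff two_ne_zero |>.1 (le_antisymm h1 (sq_nonneg _))

theorem con_nonpos_of_mem_feasSet {w : AlgVars M N} (hw : w ∈ net.feasSet a Rd Ru)
    (i : ConIdx M N) : (net.shortTerm a (fun y => y ^ 2) Rd Ru).con i w.2 ≤ 0 := by
  obtain ⟨h1, h2, h3, h4, h5, h6, h7, h8, h9, h10, h11, h12⟩ := hw
  rcases i with m | ⟨m, k⟩ | k | k | k | k | k | k | k | k | k | k | k <;>
    simp only [shortTerm, Sum.elim_inl, Sum.elim_inr, sub_nonpos, Left.neg_nonpos_iff]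
  · exact (Finset.sum_le_sum fun k _ => h7 m k).trans (h6 m)
  · exact h8 m k
  · exact pow_le_one₀ (h10 k).1 (h10 k).2
  · exact (h10 k).1
  · exact (h1 k).2
  · exact (h1 k).1
  · exact (h11 k).1
  · exact (h12 k).1
  · exact (h11 k).2
  · exact (h12 k).2
  all_goals split_ifs with hk
  all_goals first | exact le_rfl | skip
  · exact sub_nonpos.2 (h2 k hk).2
  · exact sub_nonpos.2 (h3 k hk).2
  · exact sub_nonpos.2 (h4 k hk).2

/-- A point that satisfies the constraints of the selected users is turned into a feasible point of
the algorithm by resetting the variables of the other users. -/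
theorem exists_mem_feasSet (ha : ∀ k, a k = 0 ∨ a k = 1) {x : ShortVars M N}
    (hdom : x ∈ latencyDom a) (hlin : x ∈ noPower a)
    (hcon : ∀ i, Selected a i → (net.shortTerm a (fun y => y ^ 2) Rd Ru).con i x ≤ 0)
    (hRd : ∀ k, a k = 0 → 0 ≤ Rd x.dl k) (hRu : ∀ k, a k = 0 → 0 ≤ Ru x.ul k) :
    ∃ y ∈ net.feasSet a Rd Ru, y.2.time = x.time := by
  classical
  have c1 := fun m => hcon (.inl m) trivial
  have c2 := fun m k => hcon (.inr <| .inl (m, k))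
  have c3 := fun k => hcon (.inr <| .inr <| .inl k)
  have c4 := fun k => hcon (.inr <| .inr <| .inr <| .inl k)
  have c5 := fun k => hcon (.inr <| .inr <| .inr <| .inr <| .inl k)
  have c9 := fun k => hcon (.inr <| .inr <| .inr <| .inr <| .inr <| .inr <| .inr <| .inr <| .inl k)
  have c10 := fun k =>
    hcon (.inr <| .inr <| .inr <| .inr <| .inr <| .inr <| .inr <| .inr <| .inr <| .inl k)
  have c11 := fun k =>
    hcon (.inr <| .inr <| .inr <| .inr <| .inr <| .inr <| .inr <| .inr <| .inr <| .inr <| .inl k)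
  have c12 := fun k => hcon (.inr <| .inr <| .inr <| .inr <| .inr <| .inr <| .inr <| .inr <|
    .inr <| .inr <| .inr <| .inl k)
  have c13 := fun k => hcon (.inr <| .inr <| .inr <| .inr <| .inr <| .inr <| .inr <| .inr <|
    .inr <| .inr <| .inr <| .inr k)
  simp only [shortTerm, Selected, Sum.elim_inl, Sum.elim_inr, sub_nonpos, Left.neg_nonpos_iff]
    at c1 c2 c3 c4 c5 c9 c10 c11 c12 c13
  have hsum : ∀ m k, net.var m k * x.dl m k ^ 2 ≤ 1 := fun m k =>
    (Finset.single_le_sum (f := fun k => net.var m k * x.dl m k ^ 2)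
      (fun k _ => mul_nonneg (net.var_pos m k).le (sq_nonneg _)) (Finset.mem_univ k)).trans (c1 m)
  have hzd : ∀ m k, a k = 0 → x.dl m k = 0 := fun m k hk => (hlin k hk).1 m
  have hzu : ∀ k, a k = 0 → x.ul k = 0 := fun k hk => (hlin k hk).2
  -- The auxiliary variable `ṽ` is chosen with equality in its lower bound.
  refine ⟨(fun m k => net.var m k * x.dl m k ^ 2, x.dl, fun k => if a k = 0 then 0 else x.f k, x.ul,
    fun k => if a k = 0 then 0 else x.rd k, fun k => if a k = 0 then 0 else x.ru k,
    x.td, x.tc, x.tu), ?_, rfl⟩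
  refine ⟨fun k => ?_, fun k hk => ?_, fun k hk => ?_, fun k hk => ?_, fun m k => ?_, c1,
    fun m k => le_rfl, fun m k => ?_, fun k => ?_, fun k => ?_, fun k => ?_, fun k => ?_⟩
  · by_cases hk : a k = 0
    · simp [ShortVars.f, hk, (net.fmax_pos k).le]
    · simp only [ShortVars.f, hk, if_false]
      exact ⟨(hdom k hk).2.1.le, c5 k hk⟩
  · have := c11 k hk
    simp only [ShortVars.rd, ShortVars.td, hk, if_false, sub_nonpos] at this ⊢
    exact ⟨(hdom k hk).1, this⟩
  · have := c12 k hk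
    simp only [ShortVars.f, ShortVars.tc, hk, if_false, sub_nonpos] at this ⊢
    exact ⟨(hdom k hk).2.1, this⟩
  · have := c13 k hk
    simp only [ShortVars.ru, ShortVars.tu, hk, if_false, sub_nonpos] at this ⊢
    exact ⟨(hdom k hk).2.2, this⟩
  · rcases ha k with hk | hk
    · simp [hk, hzd m k hk]
    · rw [hk]; exact hsum m k
  · by_cases hk : a k = 0
    · exact (hzd m k hk).ge
    · exact c2 m k hk
  · rcases ha k with hk | hk
    · rw [hk]; exact (by rw [hzu k hk]; simp : x.ul k ^ 2 ≤ 0)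
    · rw [hk]; exact c3 k (by simp [hk])
  · by_cases hk : a k = 0
    · exact (by rw [hzu k hk]; simp : 0 ≤ x.ul k ∧ x.ul k ≤ 1)
    · exact ⟨c4 k hk, (sq_le_one_iff₀ (c4 k hk)).1 (c3 k hk)⟩
  · by_cases hk : a k = 0
    · simp only [ShortVars.rd, ShortVars.dl, hk, if_true]
      exact ⟨le_rfl, hRd k hk⟩
    · simp only [ShortVars.rd, ShortVars.dl, hk, if_false]
      exact ⟨(hdom k hk).1.le, c9 k hk⟩
  · by_cases hk : a k = 0
    · simp only [ShortVars.ru, ShortVars.ul, hk, if_true]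
      exact ⟨le_rfl, hRu k hk⟩
    · simp only [ShortVars.ru, ShortVars.ul, hk, if_false]
      exact ⟨(hdom k hk).2.2.le, c10 k hk⟩

/-- The right-hand side is a closed condition: a positive numerator excludes `r = 0` by itself. This
is what makes the feasible sets closed. -/
theorem pos_and_div_le_iff {p r t : ℝ} (hp : 0 < p) :
    (0 < r ∧ p / r ≤ t) ↔ 0 ≤ r ∧ p ≤ t * r := by
  constructor
  · rintro ⟨hr, h⟩
    exact ⟨hr.le, (div_le_iff₀ hr).1 h⟩
  · rintro ⟨hr, h⟩
    have hr' : 0 < r := hr.lt_of_ne' (by rintro rfl; simp at h; linarith)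
    exact ⟨hr', (div_le_iff₀ hr').2 h⟩

theorem isClosed_feasSet (ha : ∀ k, a k = 0 ∨ a k = 1)
    (hRd : ∀ k, Continuous fun v => Rd v k) (hRu : ∀ k, Continuous fun u => Ru u k) :
    IsClosed (net.feasSet a Rd Ru) := by
  have hap : ∀ k, a k ≠ 0 → 0 < a k := fun k hk => by
    rw [(ha k).resolve_left hk]; exact one_pos
  have e1 : ∀ k, a k ≠ 0 → 0 < a k * net.Sd := fun k hk => mul_pos (hap k hk) net.Sd_pos
  have e2 : ∀ k, a k ≠ 0 → 0 < a k * net.L * net.D k * net.c k := fun k hk =>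
    mul_pos (mul_pos (mul_pos (hap k hk) net.L_pos) (net.D_pos k)) (net.c_pos k)
  have e3 : ∀ k, a k ≠ 0 → 0 < a k * net.Su := fun k hk => mul_pos (hap k hk) net.Su_pos
  have cd : Continuous fun w : AlgVars M N => w.2.dl := by unfold ShortVars.dl; fun_prop
  have cu : Continuous fun w : AlgVars M N => w.2.ul := by unfold ShortVars.ul; fun_prop
  have c1 : ∀ k, Continuous fun w : AlgVars M N => Rd w.2.dl k := fun k => (hRd k).comp cd
  have c2 : ∀ k, Continuous fun w : AlgVars M N => Ru w.2.ul k := fun k => (hRu k).comp cu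
  have hset : net.feasSet a Rd Ru = {w |
    (∀ k, 0 ≤ w.2.f k ∧ w.2.f k ≤ net.fmax k) ∧
    (∀ k, a k ≠ 0 → 0 ≤ w.2.rd k ∧ a k * net.Sd ≤ w.2.td * w.2.rd k) ∧
    (∀ k, a k ≠ 0 → 0 ≤ w.2.f k ∧ a k * net.L * net.D k * net.c k ≤ w.2.tc * w.2.f k) ∧
    (∀ k, a k ≠ 0 → 0 ≤ w.2.ru k ∧ a k * net.Su ≤ w.2.tu * w.2.ru k) ∧
    (∀ m k, w.1 m k ≤ a k) ∧
    (∀ m, ∑ k, w.1 m k ≤ 1) ∧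
    (∀ m k, net.var m k * w.2.dl m k ^ 2 ≤ w.1 m k) ∧
    (∀ m k, 0 ≤ w.2.dl m k) ∧
    (∀ k, w.2.ul k ^ 2 ≤ a k) ∧
    (∀ k, 0 ≤ w.2.ul k ∧ w.2.ul k ≤ 1) ∧
    (∀ k, 0 ≤ w.2.rd k ∧ w.2.rd k ≤ Rd w.2.dl k) ∧
    (∀ k, 0 ≤ w.2.ru k ∧ w.2.ru k ≤ Ru w.2.ul k)} := by
    ext w
    simp only [feasSet, Set.mem_ofPred_eq]
    refine and_congr_right' (and_congr ?_ (and_congr ?_ (and_congr_left' ?_)))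
    · exact forall_congr' fun k => forall_congr' fun hk => pos_and_div_le_iff (e1 k hk)
    · exact forall_congr' fun k => forall_congr' fun hk => pos_and_div_le_iff (e2 k hk)
    · exact forall_congr' fun k => forall_congr' fun hk => pos_and_div_le_iff (e3 k hk)
  rw [hset]
  simp only [Set.ofPred_and, Set.ofPred_forall]
  simp only [ShortVars.f, ShortVars.rd, ShortVars.ru, ShortVars.td, ShortVars.tc, ShortVars.tu,
    ShortVars.dl, ShortVars.ul] at c1 c2 ⊢
  repeat' first
    | apply IsClosed.inter
    | (apply isClosed_iInter; intro)
    | (apply isClosed_le <;> fun_prop)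

/-- Each time dominates a nonnegative quotient of some selected user. Without such a user the times
would be unbounded below. -/
theorem times_nonneg (hsel : ∃ k, a k = 1) {w : AlgVars M N}
    (hw : w ∈ net.feasSet a Rd Ru) : 0 ≤ w.2.td ∧ 0 ≤ w.2.tc ∧ 0 ≤ w.2.tu := by
  obtain ⟨k, hk⟩ := hsel
  have hk0 : a k ≠ 0 := by simp [hk]
  obtain ⟨-, h2, h3, h4, -⟩ := hw
  have q1 := net.Sd_pos.le
  have q2 := net.Su_pos.le
  have q3 := net.L_pos.le
  have q4 := (net.D_pos k).le
  have q5 := (net.c_pos k).le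
  obtain ⟨p1, r1⟩ := h2 k hk0
  obtain ⟨p2, r2⟩ := h3 k hk0
  obtain ⟨p3, r3⟩ := h4 k hk0
  rw [hk] at r1 r2 r3
  exact ⟨le_trans (by positivity) r1, le_trans (by positivity) r2, le_trans (by positivity) r3⟩

theorem time_nonneg (hsel : ∃ k, a k = 1) {w : AlgVars M N}
    (hw : w ∈ net.feasSet a Rd Ru) : 0 ≤ w.2.time := by
  obtain ⟨h1, h2, h3⟩ := net.times_nonneg hsel hw
  unfold ShortVars.time
  positivity

theorem continuous_time : Continuous fun w : AlgVars M N => w.2.time := by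
  unfold ShortVars.time ShortVars.td ShortVars.tc ShortVars.tu
  fun_prop

theorem isCompact_feasSet_inter (ha : ∀ k, a k = 0 ∨ a k = 1) (hsel : ∃ k, a k = 1)
    (hRd : ∀ k, Continuous fun v => Rd v k) (hRu : ∀ k, Continuous fun u => Ru u k) (T : ℝ) :
    IsCompact (net.feasSet a Rd Ru ∩ {w | w.2.time ≤ T}) := by
  -- The power constraint gives v² ≤ 1/σ², and v ≤ 1 + v² avoids a square root.
  let V : Fin M → Fin N → ℝ := fun m k => 1 + 1 / net.var m k
  have hCd : ∀ k, ∃ C, ∀ v ∈ Set.Icc (0 : Fin M → Fin N → ℝ) V, Rd v k ≤ C := fun k => by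
    obtain ⟨C, hC⟩ := (isCompact_Icc (a := 0) (b := V)).bddAbove_image (hRd k).continuousOn
    exact ⟨C, fun v hv => hC ⟨v, hv, rfl⟩⟩
  have hCu : ∀ k, ∃ C, ∀ u ∈ Set.Icc (0 : Fin N → ℝ) 1, Ru u k ≤ C := fun k => by
    obtain ⟨C, hC⟩ := (isCompact_Icc (a := 0) (b := 1)).bddAbove_image (hRu k).continuousOn
    exact ⟨C, fun u hu => hC ⟨u, hu, rfl⟩⟩
  choose Cd hCd using hCd
  choose Cu hCu using hCu
  have hclosed : IsClosed (net.feasSet a Rd Ru ∩ {w | w.2.time ≤ T}) :=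
    (net.isClosed_feasSet ha hRd hRu).inter (isClosed_le continuous_time continuous_const)
  let hi : AlgVars M N := (fun _ _ => 1, V, net.fmax, 1, Cd, Cu, T, T, T)
  refine (isCompact_Icc (a := (0 : AlgVars M N)) (b := hi)).of_isClosed_subset hclosed ?_
  rintro w ⟨hw, hT⟩
  obtain ⟨t1, t2, t3⟩ := net.times_nonneg hsel hw
  obtain ⟨h1, h2, h3, h4, h5, h6, h7, h8, h9, h10, h11, h12⟩ := hw
  have hT : w.2.td + w.2.tc + w.2.tu ≤ T := hT
  have ha1 : ∀ k, a k ≤ 1 := fun k => by rcases ha k with h | h <;> simp [h]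
  have hV : w.2.dl ≤ V := fun m k => by
    have p := net.var_pos m k
    have h : w.2.dl m k ^ 2 ≤ 1 / net.var m k := by
      rw [le_div_iff₀ p, mul_comm]
      exact (h7 m k).trans ((h5 m k).trans (ha1 k))
    show w.2.dl m k ≤ 1 + 1 / net.var m k
    nlinarith [sq_nonneg (w.2.dl m k - 1)]
  have hv0 : 0 ≤ w.2.dl := fun m k => h8 m k
  have hu0 : 0 ≤ w.2.ul := fun k => (h10 k).1
  have hu1 : w.2.ul ≤ 1 := fun k => (h10 k).2
  refine ⟨⟨fun m k => ?_, hv0, fun k => (h1 k).1, hu0, fun k => (h11 k).1, fun k => (h12 k).1,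
    t1, t2, t3⟩, ⟨fun m k => (h5 m k).trans (ha1 k), hV, fun k => (h1 k).2, hu1,
    fun k => (h11 k).2.trans (hCd k _ ⟨hv0, hV⟩), fun k => (h12 k).2.trans (hCu k _ ⟨hu0, hu1⟩),
    ?_, ?_, ?_⟩⟩
  · exact le_trans (mul_nonneg (net.var_pos m k).le (sq_nonneg _)) (h7 m k)
  · show w.2.td ≤ T
    linarith
  · show w.2.tc ≤ T
    linarith
  · show w.2.tu ≤ T
    linarith

/-- Without access points all downlink rates are zero, while a selected user needs a positive one.
-/
theorem pos_of_mem_feasible (hsel : ∃ k, a k = 1) {w : AlgVars M N} (hw : w ∈ net.feasible a) :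
    0 < M := by
  obtain ⟨k, hk⟩ := hsel
  obtain ⟨-, h2, -, -, -, -, -, -, -, -, h11, -⟩ := hw
  rcases Nat.eq_zero_or_pos M with rfl | h
  · have h1 := (h2 k (by simp [hk])).1.trans_le (h11 k).2
    simp [rateDAmp, Ups] at h1
  · exact h

theorem approxFeasible_subset (hM : 0 < M) (w : AlgVars M N) :
    net.approxFeasible a w ⊆ net.feasible a :=
  net.feasSet_mono (net.rateDLow_le _) (net.rateULow_le hM _)

/-- Tangency of the surrogates at the anchor. It yields both nonemptiness of the approximate problem
and descent. -/
theorem mem_approxFeasible_self (hM : 0 < M) {w : AlgVars M N} (hw : w ∈ net.feasible a) :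
    w ∈ net.approxFeasible a w := by
  obtain ⟨h1, h2, h3, h4, h5, h6, h7, h8, h9, h10, h11, h12⟩ := hw
  refine ⟨h1, h2, h3, h4, h5, h6, h7, h8, h9, h10, fun k => ?_, fun k => ?_⟩
  · rw [rateDLow_self]; exact h11 k
  · rw [rateULow_self _ hM]; exact h12 k

/-- The approximate set is unbounded in the times, so the minimum is taken over the sublevel set of
the anchor, which is compact and contains the anchor. -/
theorem exists_isStep (ha : ∀ k, a k = 0 ∨ a k = 1) (hsel : ∃ k, a k = 1) {y : AlgVars M N}
    (hy : y ∈ net.feasible a) : ∃ z, net.IsStep a y z := by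
  have hM := net.pos_of_mem_feasible hsel hy
  have hyy := net.mem_approxFeasible_self hM hy
  obtain ⟨z, hz, hmin⟩ := (net.isCompact_feasSet_inter ha hsel
    (fun k => (net.differentiable_rateDLow y.2.dl k).continuous)
    (fun k => (net.differentiable_rateULow y.2.ul k).continuous) y.2.time).exists_isMinOn
    ⟨y, hyy, le_refl y.2.time⟩ continuous_time.continuousOn
  refine ⟨z, hz.1, fun x hx => ?_⟩
  rcases le_total x.2.time y.2.time with h | h
  · exact hmin ⟨hx, h⟩
  · exact (hmin ⟨hyy, le_refl y.2.time⟩).trans h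

theorem isCompact_feasible_inter (ha : ∀ k, a k = 0 ∨ a k = 1) (hsel : ∃ k, a k = 1)
    (hM : 0 < M) (T : ℝ) : IsCompact (net.feasible a ∩ {w | w.2.time ≤ T}) :=
  net.isCompact_feasSet_inter ha hsel (fun k => (net.differentiable_rateDAmp k).continuous)
    (fun k => (net.differentiable_rateUAmp hM k).continuous) T

namespace IsRun

variable {net} {w : ℕ → AlgVars M N}

theorem mem_feasible (hw : net.IsRun a w) (hM : 0 < M) : ∀ n, w n ∈ net.feasible a
  | 0 => hw.1
  | n + 1 => net.approxFeasible_subset hM _ (hw.2 n).1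

theorem antitone_time (hw : net.IsRun a w) (hM : 0 < M) : Antitone fun n => (w n).2.time :=
  antitone_nat_of_succ_le fun n =>
    (hw.2 n).2 _ (net.mem_approxFeasible_self hM (hw.mem_feasible hM n))

theorem exists_tendsto_time (hw : net.IsRun a w) (hM : 0 < M)
    (hsel : ∃ k, a k = 1) : ∃ T : ℝ, Tendsto (fun n => (w n).2.time) atTop (𝓝 T) :=
  ⟨_, tendsto_atTop_ciInf (hw.antitone_time hM)
    ⟨0, by rintro _ ⟨n, rfl⟩; exact net.time_nonneg hsel (hw.mem_feasible hM n)⟩⟩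

theorem mem_sublevel (hw : net.IsRun a w) (hM : 0 < M) (n : ℕ) :
    w n ∈ net.feasible a ∩ {y | y.2.time ≤ (w 0).2.time} :=
  ⟨hw.mem_feasible hM n, hw.antitone_time hM n.zero_le⟩

end IsRun

end Network

/-! ### KKT conditions in the amplitude variables. -/

/-- A function that is nonpositive at `0`, and decreasing there if it vanishes, is negative
immediately to the right. -/
theorem HasDerivAt.eventually_neg_right {φ : ℝ → ℝ} {φ' : ℝ} (h : HasDerivAt φ φ' 0)
    (h0 : φ 0 ≤ 0) (h1 : φ 0 = 0 → φ' < 0) : ∀ᶠ t in 𝓝[>] (0 : ℝ), φ t < 0 := by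
  rcases h0.lt_or_eq with hlt | heq
  · exact nhdsWithin_le_nhds (h.continuousAt.eventually_lt continuousAt_const hlt)
  · filter_upwards [h.tendsto_slope_zero_right.eventually_lt_const (h1 heq), self_mem_nhdsWithin]
      with t ht htpos
    have htpos : 0 < t := htpos
    simp only [zero_add, heq, sub_zero, smul_eq_mul] at ht
    by_contra hge
    exact absurd ht (not_lt.2 (mul_nonneg (inv_nonneg.2 htpos.le) (not_lt.1 hge)))

/-- `exists_multipliers` for the constraints that satisfy a predicate. -/
theorem exists_multipliers_of_pred {E J : Type*} [AddCommGroup E] [Module ℝ E] [Fintype J]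
    (lin : Submodule ℝ E) (c : E →ₗ[ℝ] ℝ) (g : J → E →ₗ[ℝ] ℝ) (p : J → Prop)
    (hno : ∀ d ∈ lin, (∀ j, p j → g j d < 0) → 0 ≤ c d)
    (hreg : ∃ d ∈ lin, ∀ j, p j → g j d < 0) :
    ∃ lam : J → ℝ, (∀ j, 0 ≤ lam j) ∧ (∀ j, ¬ p j → lam j = 0) ∧
      ∀ d ∈ lin, c d + ∑ j, lam j * g j d = 0 := by
  classical
  obtain ⟨lam, h1, h2⟩ := exists_multipliers lin c (fun j : {j // p j} => g j)
    (fun d hd h => hno d hd fun j hj => h ⟨j, hj⟩)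
    (hreg.imp fun d hd => ⟨hd.1, fun j => hd.2 j j.2⟩)
  refine ⟨fun j => if h : p j then lam ⟨j, h⟩ else 0, fun j => ?_, fun j hj => dif_neg hj,
    fun d hd => ?_⟩
  · dsimp only
    split_ifs
    exacts [h1 _, le_rfl]
  · have h3 : ∑ j : {j // ¬ p j}, (if h : p j then lam ⟨j, h⟩ else 0) * g j d = 0 :=
      Finset.sum_eq_zero fun j _ => by rw [dif_neg j.2, zero_mul]
    have h4 : ∑ j : {j // p j}, (if h : p j then lam ⟨j, h⟩ else 0) * g j d =
        ∑ j : {j // p j}, lam j * g j d :=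
      Finset.sum_congr rfl fun j _ => by rw [dif_pos j.2]
    rw [← Fintype.sum_subtype_add_sum_subtype p, h3, h4, add_zero, h2 d hd]

namespace ShortVars

variable {M N : ℕ}

theorem differentiable_time : Differentiable ℝ (time : ShortVars M N → ℝ) := by
  unfold time td tc tu
  fun_prop

theorem time_add_smul (x d : ShortVars M N) (t : ℝ) : (x + t • d).time = x.time + t * d.time := by
  simp only [time, td, tc, tu, Prod.snd_add, Prod.fst_add, Prod.smul_snd, Prod.smul_fst,
    smul_eq_mul]
  ring

end ShortVars

namespace Network

variable {M N : ℕ} (net : Network M N)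
variable {a : Fin N → ℝ} {Rd : (Fin M → Fin N → ℝ) → Fin N → ℝ} {Ru : (Fin N → ℝ) → Fin N → ℝ}

theorem isOpen_latencyDom : IsOpen (latencyDom a : Set (ShortVars M N)) := by
  have : (latencyDom a : Set (ShortVars M N)) =
      ⋂ k, ⋂ (_ : a k ≠ 0), {x | 0 < x.rd k} ∩ ({x | 0 < x.f k} ∩ {x | 0 < x.ru k}) := by
    ext x
    simp [latencyDom]
  rw [this]
  simp only [ShortVars.f, ShortVars.rd, ShortVars.ru]
  refine isOpen_iInter_of_finite fun k => isOpen_iInter_of_finite fun _ => ?_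
  refine (isOpen_lt ?_ ?_).inter ((isOpen_lt ?_ ?_).inter (isOpen_lt ?_ ?_)) <;> fun_prop

theorem differentiableAt_con (hRd : ∀ k, Differentiable ℝ fun v => Rd v k)
    (hRu : ∀ k, Differentiable ℝ fun u => Ru u k) {x : ShortVars M N} (hx : x ∈ latencyDom a)
    (i : ConIdx M N) :
    DifferentiableAt ℝ ((net.shortTerm a (fun y => y ^ 2) Rd Ru).con i) x := by
  have hd : ∀ k, Differentiable ℝ fun x : ShortVars M N => Rd x.dl k := fun k =>
    (hRd k).comp differentiable_fst
  have hu : ∀ k, Differentiable ℝ fun x : ShortVars M N => Ru x.ul k := fun k =>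
    (hRu k).comp (differentiable_fst.comp (differentiable_snd.comp differentiable_snd))
  rcases i with m | ⟨m, k⟩ | k | k | k | k | k | k | k | k | k | k | k <;>
    simp only [shortTerm, Sum.elim_inl, Sum.elim_inr]
  case inr.inr.inr.inr.inr.inr.inr.inr.inl => 
    exact (by unfold ShortVars.rd; fun_prop :
      DifferentiableAt ℝ (fun x : ShortVars M N => x.rd k) x).sub (hd k x)
  case inr.inr.inr.inr.inr.inr.inr.inr.inr.inl => 
    exact (by unfold ShortVars.ru; fun_prop :
      DifferentiableAt ℝ (fun x : ShortVars M N => x.ru k) x).sub (hu k x)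
  case inr.inr.inr.inr.inr.inr.inr.inr.inr.inr.inl =>
    split_ifs with hk
    · fun_prop
    · have := (hx k hk).1.ne'
      simp only [ShortVars.rd, ShortVars.td] at this ⊢
      fun_prop (disch := assumption)
  case inr.inr.inr.inr.inr.inr.inr.inr.inr.inr.inr.inl =>
    split_ifs with hk
    · fun_prop
    · have := (hx k hk).2.1.ne'
      simp only [ShortVars.f, ShortVars.tc] at this ⊢
      fun_prop (disch := assumption)
  case inr.inr.inr.inr.inr.inr.inr.inr.inr.inr.inr.inr =>
    split_ifs with hk
    · fun_prop
    · have := (hx k hk).2.2.ne'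
      simp only [ShortVars.ru, ShortVars.tu] at this ⊢
      fun_prop (disch := assumption)
  all_goals
    simp only [ShortVars.dl, ShortVars.ul, ShortVars.f, ShortVars.rd, ShortVars.ru]
    fun_prop

theorem differentiableAt_con_shortPAmp (hM : 0 < M) {x : ShortVars M N} (hx : x ∈ latencyDom a)
    (i : ConIdx M N) : DifferentiableAt ℝ ((net.shortPAmp a).con i) x :=
  net.differentiableAt_con net.differentiable_rateDAmp (net.differentiable_rateUAmp hM) hx i

/-- The convex inner approximation, anchored at `x0`, in the form of a nonlinear program. -/
noncomputable def approxP (a : Fin N → ℝ) (x0 : ShortVars M N) : NLP (ShortVars M N) (ConIdx M N) :=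
  net.shortTerm a (fun y => y ^ 2) (net.rateDLow x0.dl) (net.rateULow x0.ul)

theorem approxP_con_self (hM : 0 < M) (x : ShortVars M N) (i : ConIdx M N) :
    (net.approxP a x).con i x = (net.shortPAmp a).con i x := by
  rcases i with m | ⟨m, k⟩ | k | k | k | k | k | k | k | k | k | k | k
  case inr.inr.inr.inr.inr.inr.inr.inr.inl =>
    exact congrArg (x.rd k - ·) (net.rateDLow_self x.dl k)
  case inr.inr.inr.inr.inr.inr.inr.inr.inr.inl =>
    exact congrArg (x.ru k - ·) (net.rateULow_self hM x.ul k)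
  all_goals rfl

theorem approxP_con_ge (hM : 0 < M) (x0 x : ShortVars M N) (i : ConIdx M N) :
    (net.shortPAmp a).con i x ≤ (net.approxP a x0).con i x := by
  rcases i with m | ⟨m, k⟩ | k | k | k | k | k | k | k | k | k | k | k
  case inr.inr.inr.inr.inr.inr.inr.inr.inl =>
    exact sub_le_sub_left (net.rateDLow_le x0.dl x.dl k) _
  case inr.inr.inr.inr.inr.inr.inr.inr.inr.inl =>
    exact sub_le_sub_left (net.rateULow_le hM x0.ul x.ul k) _
  all_goals exact le_rfl

theorem continuous_approxP_con (hM : 0 < M) (x : ShortVars M N) (i : ConIdx M N) :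
    Continuous fun x0 => (net.approxP a x0).con i x := by
  rcases i with m | ⟨m, k⟩ | k | k | k | k | k | k | k | k | k | k | k
  case inr.inr.inr.inr.inr.inr.inr.inr.inl =>
    exact continuous_const.sub ((net.continuous_rateDLow_anchor x.dl k).comp continuous_fst)
  case inr.inr.inr.inr.inr.inr.inr.inr.inr.inl =>
    exact continuous_const.sub ((net.continuous_rateULow_anchor hM x.ul k).comp
      (continuous_fst.comp (continuous_snd.comp continuous_snd)))
  all_goals exact continuous_const

/-- The surrogate constraint majorizes the true one and touches it at the anchor, so equality of the
derivatives needs no gradient computation. -/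
theorem hasFDerivAt_approxP_con (hM : 0 < M) {x : ShortVars M N} (hx : x ∈ latencyDom a)
    (i : ConIdx M N) {g : ShortVars M N →L[ℝ] ℝ} (hg : HasFDerivAt ((net.shortPAmp a).con i) g x) :
    HasFDerivAt ((net.approxP a x).con i) g x :=
  hg.of_majorant (net.differentiableAt_con (net.differentiable_rateDLow x.dl)
    (net.differentiable_rateULow x.ul) hx i) (fun y => net.approxP_con_ge hM x y i)
    (net.approxP_con_self hM x i).symm

/-- Mangasarian-Fromovitz constraint qualification for the constraints of the selected users. -/
theorem exists_strict_direction (hM : 0 < M) {z : AlgVars M N}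
    (hz : z ∈ net.feasible a) {g : ConIdx M N → ShortVars M N →L[ℝ] ℝ}
    (hg : ∀ i, HasFDerivAt ((net.shortPAmp a).con i) (g i) z.2) :
    ∃ d ∈ noPower a, ∀ i, Selected a i ∧ (net.shortPAmp a).con i z.2 = 0 → g i d < 0 := by
  classical
  have hdom := net.mem_latencyDom_of_mem_feasSet hz
  have hlin := net.mem_noPower_of_mem_feasSet hz
  obtain ⟨x, hx⟩ : ∃ x, x = z.2 := ⟨_, rfl⟩
  rw [← hx] at hg hdom hlin ⊢
  have hline : ∀ i (d : ShortVars M N) {D : ℝ},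
      HasDerivAt (fun t : ℝ => (net.shortPAmp a).con i (x + t • d)) D 0 → g i d = D :=
    fun i d D hD => ((hg i).hasDerivAt_line d).unique hD
  -- Zero amplitudes of selected users grow and nonzero ones shrink proportionally. In every case
  -- amplitude times direction is minus the squared amplitude (`hvd`, `hud`), so an active power
  -- constraint decreases strictly.
  let V : Fin M → Fin N → ℝ := fun m k =>
    if a k = 0 then 0 else if x.dl m k = 0 then 1 else - x.dl m k
  let U : Fin N → ℝ := fun k => if a k = 0 then 0 else if x.ul k = 0 then 1 else - x.ul k
  -- The auxiliary rates move by the derivative of the true rate minus 1, so the rate constraints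
  -- have slope -1. The times then grow fast enough to absorb the change of every latency quotient.
  let gd : Fin N → ℝ := fun k => fderiv ℝ (fun v => net.rateDAmp v k) x.dl V - 1
  let gu : Fin N → ℝ := fun k => fderiv ℝ (fun u => net.rateUAmp u k) x.ul U - 1
  let T1 : ℝ := 1 + ∑ k, |a k * net.Sd * gd k / x.rd k ^ 2|
  let T2 : ℝ := 1 + ∑ k, |a k * net.L * net.D k * net.c k * (-1) / x.f k ^ 2|
  let T3 : ℝ := 1 + ∑ k, |a k * net.Su * gu k / x.ru k ^ 2|
  let d : ShortVars M N := (V, fun _ => -1, U, gd, gu, T1, T2, T3)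
  have hvd : ∀ m k, x.dl m k * V m k = - x.dl m k ^ 2 := fun m k => by
    simp only [V]
    split_ifs with h1 h2
    · simp [(hlin k h1).1 m]
    · simp [h2]
    · ring
  have hud : ∀ k, x.ul k * U k = - x.ul k ^ 2 := fun k => by
    simp only [U]
    split_ifs with h1 h2
    · simp [(hlin k h1).2]
    · simp [h2]
    · ring
  have hl : ∀ y e : ℝ, HasDerivAt (fun t : ℝ => y + t * e) e 0 := hasDerivAt_line
  have hsq : ∀ y e : ℝ, HasDerivAt (fun t : ℝ => (y + t * e) ^ 2) (2 * (y * e)) 0 := fun y e => by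
    have := (hl y e).fun_pow 2
    simp only [zero_mul, add_zero] at this
    exact this.congr_deriv (by norm_num; ring)
  have hquot : ∀ A y e s τ : ℝ, 0 < y →
      HasDerivAt (fun t : ℝ => A / (y + t * e) - (s + t * τ)) (-(A * e / y ^ 2) - τ) 0 := by
    intro A y e s τ hy
    have h1 := (hasDerivAt_const (0 : ℝ) A).fun_div (hl y e) (by simpa using hy.ne')
    exact (h1.sub (hl s τ)).congr_deriv (by simp; ring)
  have hT : ∀ (f : Fin N → ℝ) k, -f k - (1 + ∑ k, |f k|) < 0 := fun f k => by
    have h1 := Finset.single_le_sum (f := fun k => |f k|) (fun k _ => abs_nonneg _)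
      (Finset.mem_univ k)
    have h2 := neg_abs_le (f k)
    linarith
  refine ⟨d, fun k hk => ⟨fun m => if_pos hk, if_pos hk⟩, ?_⟩
  rintro (m | ⟨m, k⟩ | k | k | k | k | k | k | k | k | k | k | k) ⟨hi, hact⟩
  · have hD : HasDerivAt (fun t : ℝ => ∑ k, net.var m k * (x.dl m k + t * V m k) ^ 2 - 1)
        (∑ k, net.var m k * (2 * (x.dl m k * V m k))) 0 :=
      (HasDerivAt.fun_sum fun k _ => (hsq _ _).const_mul _).sub_const 1
    refine lt_of_eq_of_lt (hline _ d hD) ?_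
    have h1 : ∑ k, net.var m k * x.dl m k ^ 2 - 1 = 0 := hact
    have h2 : ∑ k, net.var m k * (2 * (x.dl m k * V m k)) =
        -2 * ∑ k, net.var m k * x.dl m k ^ 2 := by
      rw [Finset.mul_sum]
      exact Finset.sum_congr rfl fun k _ => by rw [hvd]; ring
    rw [h2]
    linarith
  · have hk : a k ≠ 0 := hi
    have h0 : - x.dl m k = 0 := hact
    refine lt_of_eq_of_lt (hline _ d (hl (x.dl m k) (V m k)).neg) ?_
    simp [V, hk, neg_eq_zero.1 h0]
  · have h0 : x.ul k ^ 2 - 1 = 0 := hact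
    refine lt_of_eq_of_lt (hline _ d ((hsq (x.ul k) (U k)).sub_const 1)) ?_
    rw [hud]
    linarith
  · have hk : a k ≠ 0 := hi
    have h0 : - x.ul k = 0 := hact
    refine lt_of_eq_of_lt (hline _ d (hl (x.ul k) (U k)).neg) ?_
    simp [U, hk, neg_eq_zero.1 h0]
  · refine lt_of_eq_of_lt (hline _ d ((hl (x.f k) (-1)).sub_const (net.fmax k))) ?_
    norm_num
  · exact absurd (neg_eq_zero.1 hact) (hdom k hi).2.1.ne'
  · exact absurd (neg_eq_zero.1 hact) (hdom k hi).1.ne'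
  · exact absurd (neg_eq_zero.1 hact) (hdom k hi).2.2.ne'
  · refine lt_of_eq_of_lt (hline _ d ((hl (x.rd k) (gd k)).sub
      ((net.differentiable_rateDAmp k x.dl).hasFDerivAt.hasDerivAt_line V))) ?_
    simp [gd]
  · refine lt_of_eq_of_lt (hline _ d ((hl (x.ru k) (gu k)).sub
      ((net.differentiable_rateUAmp hM k x.ul).hasFDerivAt.hasDerivAt_line U))) ?_
    simp [gu]
  · have hk : a k ≠ 0 := hi
    have hD := hquot (a k * net.Sd) (x.rd k) (gd k) x.td T1 (hdom k hk).1
    refine lt_of_eq_of_lt (hline _ d ?_) (hT (fun k => a k * net.Sd * gd k / x.rd k ^ 2) k)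
    simp only [shortPAmp, shortTerm, Sum.elim_inl, Sum.elim_inr, hk, if_false]
    exact hD
  · have hk : a k ≠ 0 := hi
    have hD := hquot (a k * net.L * net.D k * net.c k) (x.f k) (-1) x.tc T2 (hdom k hk).2.1
    refine lt_of_eq_of_lt (hline _ d ?_)
      (hT (fun k => a k * net.L * net.D k * net.c k * (-1) / x.f k ^ 2) k)
    simp only [shortPAmp, shortTerm, Sum.elim_inl, Sum.elim_inr, hk, if_false]
    exact hD
  · have hk : a k ≠ 0 := hi
    have hD := hquot (a k * net.Su) (x.ru k) (gu k) x.tu T3 (hdom k hk).2.2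
    refine lt_of_eq_of_lt (hline _ d ?_) (hT (fun k => a k * net.Su * gu k / x.ru k ^ 2) k)
    simp only [shortPAmp, shortTerm, Sum.elim_inr, hk, if_false]
    exact hD

/-- A feasible point which no approximate problem anchored nearby improves satisfies the
Karush-Kuhn-Tucker conditions. -/
theorem isKKT_of_frequently (hM : 0 < M) (ha : ∀ k, a k = 0 ∨ a k = 1) {z : AlgVars M N}
    (hz : z ∈ net.feasible a)
    (hopt : ∃ᶠ w0 in 𝓝 z, w0 ∈ net.feasible a ∧
      ∀ y ∈ net.approxFeasible a w0, z.2.time ≤ y.2.time) :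
    (net.shortPAmp a).IsKKT z.2 := by
  have hdom : z.2 ∈ latencyDom a := net.mem_latencyDom_of_mem_feasSet hz
  have hlin : z.2 ∈ noPower a := net.mem_noPower_of_mem_feasSet hz
  have hcon : ∀ i, (net.shortPAmp a).con i z.2 ≤ 0 := net.con_nonpos_of_mem_feasSet hz
  have hg := fun i => (net.differentiableAt_con_shortPAmp hM hdom i).hasFDerivAt
  have hc := (ShortVars.differentiable_time z.2).hasFDerivAt
  have hcd : ∀ d, fderiv ℝ ShortVars.time z.2 d = d.time := fun d => by
    refine (hc.hasDerivAt_line d).unique ?_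
    simp only [ShortVars.time_add_smul]
    simpa using ((hasDerivAt_id (0 : ℝ)).mul_const d.time).const_add z.2.time
  obtain ⟨lam, h1, h2, h3⟩ := exists_multipliers_of_pred (noPower a)
    (fderiv ℝ ShortVars.time z.2).toLinearMap
    (fun i => (fderiv ℝ ((net.shortPAmp a).con i) z.2).toLinearMap)
    (fun i => Selected a i ∧ (net.shortPAmp a).con i z.2 = 0)
    (by
      intro d hd hgd
      by_contra hneg
      have hneg : d.time < 0 := by
        rw [← hcd]
        exact not_le.1 hneg
      have hline : Continuous fun t : ℝ => z.2 + t • d := by fun_prop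
      have e1 : ∀ᶠ t : ℝ in 𝓝[>] 0, z.2 + t • d ∈ latencyDom a :=
        nhdsWithin_le_nhds (hline.continuousAt.eventually_mem
          (isOpen_latencyDom.mem_nhds (by simpa using hdom)))
      have e2 : ∀ᶠ t : ℝ in 𝓝[>] 0, ∀ i, Selected a i →
          (net.approxP a z.2).con i (z.2 + t • d) < 0 := by
        refine eventually_all.2 fun i => ?_
        by_cases hi : Selected a i
        · have hD := (net.hasFDerivAt_approxP_con hM hdom i (hg i)).hasDerivAt_line d
          have hv : (net.approxP a z.2).con i (z.2 + (0 : ℝ) • d) =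
              (net.shortPAmp a).con i z.2 := by
            rw [zero_smul, add_zero, net.approxP_con_self hM]
          filter_upwards [hD.eventually_neg_right (hv.trans_le (hcon i))
            fun h => hgd i ⟨hi, hv.symm.trans h⟩] with t ht _ using ht
        · exact Eventually.of_forall fun t h => absurd h hi
      -- The step length is fixed first, with anchor `z`; only then does the anchor vary.
      obtain ⟨t, ⟨ht1, ht2⟩, ht0⟩ := ((e1.and e2).and self_mem_nhdsWithin).exists
      have ht0 : 0 < t := ht0
      have e3 : ∀ᶠ w0 in 𝓝 z, ∀ i, Selected a i →
          (net.approxP a w0.2).con i (z.2 + t • d) < 0 := by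
        refine eventually_all.2 fun i => ?_
        by_cases hi : Selected a i
        · filter_upwards [((net.continuous_approxP_con hM (z.2 + t • d) i).comp
            continuous_snd).continuousAt.eventually_lt (continuousAt_const (y := (0 : ℝ)))
            (ht2 i hi)] with w0 h _ using h
        · exact Eventually.of_forall fun t h => absurd h hi
      obtain ⟨w0, ⟨hw0, hw0min⟩, hw0con⟩ := (hopt.and_eventually e3).exists
      have hw0lin := net.mem_noPower_of_mem_feasSet hw0
      -- Only the selected constraints are controlled at the moved point. Resetting the other users
      -- gives feasibility without changing the time.
      obtain ⟨y, hy, hyt⟩ := net.exists_mem_feasSet ha ht1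
        ((noPower a).add_mem hlin ((noPower a).smul_mem t hd)) (fun i hi => (hw0con i hi).le)
        (fun k hk => (net.rateDLow_eq_zero (hw0lin k hk).1 _).ge)
        (fun k hk => (net.rateULow_eq_zero (hw0lin k hk).2 _).ge)
      have := hw0min y hy
      rw [hyt, ShortVars.time_add_smul] at this
      nlinarith)
    (net.exists_strict_direction hM hz hg)
  refine ⟨hdom, hlin, hcon, _, _, lam, hc.hasFDerivWithinAt, fun i => (hg i).hasFDerivWithinAt, h1,
    fun i => ?_, h3⟩
  by_cases h : (net.shortPAmp a).con i z.2 = 0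
  · rw [h, mul_zero]
  · rw [h2 i fun hi => h hi.2, zero_mul]

end Network

/-! ### Transfer from amplitudes to power control coefficients. -/

namespace Network

variable {M N : ℕ} (net : Network M N)
variable {a : Fin N → ℝ}

theorem rateD_sq {v : Fin M → Fin N → ℝ} (hv : ∀ m k, 0 ≤ v m k) (k : Fin N) :
    net.rateD (fun m k => v m k ^ 2) k = net.rateDAmp v k := by
  simp only [rateD, rateDAmp, Ups, Pii, mul_pow, Real.sq_sqrt net.rhoD_pos.le,
    Real.sqrt_sq (hv _ _)]

theorem rateU_sq (u : Fin N → ℝ) (k : Fin N) :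
    net.rateU (fun k => u k ^ 2) k = net.rateUAmp u k := by
  simp only [rateU, rateUAmp, Psi, Xii, mul_pow, Real.sq_sqrt net.rhoU_pos.le]

theorem toPower_mem_noPower {x : ShortVars M N} (hx : x ∈ noPower a) :
    x.toPower ∈ noPower a := fun k hk =>
  ⟨fun m => by
    show x.dl m k ^ 2 = 0
    rw [(hx k hk).1 m, zero_pow two_ne_zero], by
    show x.ul k ^ 2 = 0
    rw [(hx k hk).2, zero_pow two_ne_zero]⟩

/-- The directional derivative of `ShortVars.toPower`. -/
theorem hasDerivAt_toPower (x d : ShortVars M N) :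
    HasDerivAt (fun t : ℝ => (x + t • d).toPower)
      ((fun m k => 2 * x.dl m k * d.dl m k, d.f, fun k => 2 * x.ul k * d.ul k, d.rd, d.ru,
        d.td, d.tc, d.tu) : ShortVars M N) 0 := by
  have hsq : ∀ y e : ℝ, HasDerivAt (fun t : ℝ => (y + t * e) ^ 2) (2 * y * e) 0 := fun y e => by
    have := (hasDerivAt_line y e).fun_pow 2
    simp only [zero_smul, add_zero] at this
    exact this.congr_deriv (by norm_num)
  exact (hasDerivAt_pi.2 fun m => hasDerivAt_pi.2 fun k => hsq (x.dl m k) (d.dl m k)).prodMk <|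
    (hasDerivAt_line x.f d.f).prodMk <|
    (hasDerivAt_pi.2 fun k => hsq (x.ul k) (d.ul k)).prodMk <|
    (hasDerivAt_line x.rd d.rd).prodMk <| (hasDerivAt_line x.ru d.ru).prodMk <|
    (hasDerivAt_line x.td d.td).prodMk <| (hasDerivAt_line x.tc d.tc).prodMk <|
    hasDerivAt_line x.tu d.tu

/-- The perturbed entry starts at zero, so its cross terms vanish, and the coherent interference
omits user `k`. Hence the denominator changes only to second order, and the slope comes from the
signal alone. -/
theorem hasDerivAt_rateDAmp_single {v : Fin M → Fin N → ℝ} {m₀ : Fin M} {k : Fin N}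
    (hv : v m₀ k = 0) :
    HasDerivAt (fun t : ℝ => net.rateDAmp (v + t • (Pi.single m₀ (Pi.single k 1) : Fin M → Fin N → ℝ)) k)
      (net.scale * (2 * net.Ups v k * (√net.rhoD * net.var m₀ k) / net.Pii v k /
        (1 + net.Ups v k ^ 2 / net.Pii v k))) 0 := by
  let e : Fin M → Fin N → ℝ := Pi.single m₀ (Pi.single k 1)
  have he : ∀ m l, v m l * e m l = 0 := fun m l => by
    by_cases h : m = m₀
    · subst h
      by_cases h' : l = k
      · subst h'; simp [hv]
      · simp [e, h']
    · simp [e, h]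
  have he0 : ∀ m l, l ≠ k → e m l = 0 := fun m l h' => by
    by_cases h : m = m₀
    · subst h; simp [e, h']
    · simp [e, h]
  have hP : ∀ t : ℝ, net.Pii (v + t • e) k = net.Pii v k +
      t ^ 2 * (net.rhoD * ∑ l, ∑ m, e m l ^ 2 * net.var m l * net.beta m k) := by
    intro t
    have h1 : ∑ l ∈ Finset.univ.erase k, (∑ m, (v + t • e) m l * net.var m l *
          (net.beta m k / net.beta m l)) ^ 2 * net.corr l k =
        ∑ l ∈ Finset.univ.erase k, (∑ m, v m l * net.var m l *
          (net.beta m k / net.beta m l)) ^ 2 * net.corr l k :=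
      Finset.sum_congr rfl fun l hl => by
        simp [he0 _ l (Finset.ne_of_mem_erase hl)]
    have h2 : ∑ l, ∑ m, (v + t • e) m l ^ 2 * net.var m l * net.beta m k =
        ∑ l, ∑ m, v m l ^ 2 * net.var m l * net.beta m k +
        t ^ 2 * ∑ l, ∑ m, e m l ^ 2 * net.var m l * net.beta m k := by
      simp only [Finset.mul_sum, ← Finset.sum_add_distrib]
      refine Finset.sum_congr rfl fun l _ => Finset.sum_congr rfl fun m _ => ?_
      simp only [Pi.add_apply, Pi.smul_apply, smul_eq_mul]
      linear_combination 2 * t * net.var m l * net.beta m k * he m l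
    simp only [Pii, h1, h2]
    ring
  have hU : ∀ t : ℝ, net.Ups (v + t • e) k = net.Ups v k + t * (√net.rhoD * net.var m₀ k) := by
    intro t
    have h1 : ∑ m, e m k * net.var m k = net.var m₀ k := by
      rw [Finset.sum_eq_single m₀]
      · simp [e]
      · intro m _ h; simp [e, h]
      · simp
    simp only [Ups, Pi.add_apply, Pi.smul_apply, smul_eq_mul, add_mul, Finset.sum_add_distrib,
      mul_assoc, ← Finset.mul_sum, h1]
    ring
  have hq := net.Pii_pos v k
  simp only [rateDAmp_eq]
  change HasDerivAt (fun t : ℝ => net.scale *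
    Real.log (1 + net.Ups (v + t • e) k ^ 2 / net.Pii (v + t • e) k)) _ 0
  simp only [hU, hP]
  have hs := (hasDerivAt_line (net.Ups v k) (√net.rhoD * net.var m₀ k)).fun_pow 2
  have hp := (((hasDerivAt_id (0 : ℝ)).fun_pow 2).mul_const
    (net.rhoD * ∑ l, ∑ m, e m l ^ 2 * net.var m l * net.beta m k)).const_add (net.Pii v k)
  have h := (((hs.fun_div hp (by simpa using hq.ne')).const_add 1).log
    (by simp; positivity)).const_mul net.scale
  simp only [smul_eq_mul, id] at h
  refine h.congr_deriv (congrArg (net.scale * ·) ?_)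
  simp
  field_simp

theorem Ups_pos_of_mem_feasible {z : AlgVars M N} (hz : z ∈ net.feasible a) {k : Fin N}
    (hk : a k ≠ 0) : 0 < net.Ups z.2.dl k := by
  obtain ⟨-, h2, -, -, -, -, -, h8, -, -, h11, -⟩ := hz
  have h1 := (h2 k hk).1.trans_le (h11 k).2
  refine lt_of_le_of_ne' ?_ fun h => ?_
  · exact mul_nonneg (Real.sqrt_nonneg _) (Finset.sum_nonneg fun m _ =>
      mul_nonneg (h8 m k) (net.var_pos m k).le)
  · simp [rateDAmp, h] at h1

theorem ul_pos_of_mem_feasible {z : AlgVars M N} (hz : z ∈ net.feasible a) {k : Fin N}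
    (hk : a k ≠ 0) : 0 < z.2.ul k := by
  obtain ⟨-, -, -, h4, -, -, -, -, -, h10, -, h12⟩ := hz
  have h1 := (h4 k hk).1.trans_le (h12 k).2
  refine lt_of_le_of_ne' (h10 k).1 fun h => ?_
  simp [rateUAmp, Psi, h] at h1

/-- The downlink rate of a selected user is not differentiable at a point at which one of its power
coefficients vanishes. -/
theorem dl_pos_of_diffAt {z : AlgVars M N} (hz : z ∈ net.feasible a)
    (hD : (net.shortP a).DiffAt z.2.toPower) {k : Fin N} (hk : a k ≠ 0) (m : Fin M) :
    0 < z.2.dl m k := by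
  have hlin := net.mem_noPower_of_mem_feasSet hz
  have hv : ∀ m k, 0 ≤ z.2.dl m k := hz.2.2.2.2.2.2.2.1
  refine lt_of_le_of_ne' (hv m k) fun h0 => ?_
  let e : Fin M → Fin N → ℝ := Pi.single m (Pi.single k 1)
  have he : ∀ m' l, (m' = m ∧ l = k) ∨ e m' l = 0 := fun m' l => by
    by_cases h : m' = m
    · subst h
      by_cases h' : l = k
      · exact .inl ⟨rfl, h'⟩
      · simp [e, h']
    · simp [e, h]
  have he0 : ∀ m' l, 0 ≤ e m' l := fun m' l => by
    rcases he m' l with ⟨rfl, rfl⟩ | h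
    · simp [e]
    · exact h.ge
  let d : ShortVars M N := (e, 0)
  have hd : d ∈ noPower a := fun l hl => ⟨fun m' => by
    rcases he m' l with ⟨rfl, rfl⟩ | h
    · exact absurd hl hk
    · exact h, rfl⟩
  have hγ := hasDerivAt_toPower z.2 d
  -- The squared curve starts with zero velocity, so differentiability in η would force the rate to
  -- have slope zero along it. In the amplitudes that slope is positive.
  have hγ0 : ((fun m k => 2 * z.2.dl m k * d.dl m k, d.f, fun k => 2 * z.2.ul k * d.ul k, d.rd,
      d.ru, d.td, d.tc, d.tu) : ShortVars M N) = 0 := by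
    refine Prod.ext (funext fun m' => funext fun l => ?_)
      (Prod.ext rfl (Prod.ext (funext fun l => mul_zero _) rfl))
    show 2 * z.2.dl m' l * e m' l = 0
    rcases he m' l with ⟨rfl, rfl⟩ | h
    · rw [h0]; ring
    · rw [h, mul_zero]
  rw [hγ0] at hγ
  have h1 := (hD.2 (.inr <| .inr <| .inr <| .inr <| .inr <| .inr <| .inr <| .inr <|
    .inl k)).hasFDerivWithinAt.hasDerivAt_curve hγ (by simp)
    fun t => toPower_mem_noPower ((noPower a).add_mem hlin ((noPower a).smul_mem t hd))
  rw [map_zero] at h1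
  have h2 := (net.hasDerivAt_rateDAmp_single h0).const_sub (z.2.rd k)
  -- √(v²) = v holds only for nonnegative amplitudes, hence the comparison of one-sided derivatives.
  have h3 : Set.EqOn (fun t : ℝ => (net.shortP a).con (.inr <| .inr <| .inr <| .inr <| .inr <|
      .inr <| .inr <| .inr <| .inl k) (z.2 + t • d).toPower)
      (fun t => z.2.rd k - net.rateDAmp (z.2.dl + t • e) k) (Set.Ici 0) := fun t ht => by
    have ht : 0 ≤ t := ht
    have h4 : net.rateD (fun m l => (z.2.dl + t • e) m l ^ 2) k =
        net.rateDAmp (z.2.dl + t • e) k :=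
      net.rateD_sq (fun m l => add_nonneg (hv m l) (mul_nonneg ht (he0 m l))) k
    have h5 : z.2.rd k + t * 0 - net.rateD (fun m l => (z.2.dl + t • e) m l ^ 2) k =
        z.2.rd k - net.rateDAmp (z.2.dl + t • e) k := by rw [h4, mul_zero, add_zero]
    exact h5
  have h4 := (uniqueDiffOn_Ici (0 : ℝ) 0 Set.self_mem_Ici).eq_deriv _
    (h1.hasDerivWithinAt (s := Set.Ici 0))
    ((h2.hasDerivWithinAt (s := Set.Ici 0)).congr h3 (h3 Set.self_mem_Ici))
  have q1 := net.scale_pos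
  have q2 := net.Ups_pos_of_mem_feasible hz hk
  have q3 := net.Pii_pos z.2.dl k
  have q4 := net.var_pos m k
  have q5 := Real.sqrt_pos.2 net.rhoD_pos
  exact (neg_lt_zero.2 (by positivity : 0 < net.scale * (2 * net.Ups z.2.dl k *
    (√net.rhoD * net.var m k) / net.Pii z.2.dl k /
      (1 + net.Ups z.2.dl k ^ 2 / net.Pii z.2.dl k)))).ne h4.symm

theorem shortP_con_toPower {x : ShortVars M N} (hx : ∀ m k, 0 ≤ x.dl m k) (i : ConIdx M N) :
    (net.shortP a).con i x.toPower = (net.shortPAmp a).con i x ∨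
    (∃ m k, i = .inr (.inl (m, k))) ∨ ∃ k, i = .inr (.inr (.inr (.inl k))) := by
  rcases i with m | ⟨m, k⟩ | k | k | k | k | k | k | k | k | k | k | k
  case inr.inl => exact .inr (.inl ⟨m, k, rfl⟩)
  case inr.inr.inr.inl => exact .inr (.inr ⟨k, rfl⟩)
  case inr.inr.inr.inr.inr.inr.inr.inr.inl =>
    exact .inl (congrArg (x.rd k - ·) (net.rateD_sq hx k))
  case inr.inr.inr.inr.inr.inr.inr.inr.inr.inl =>
    exact .inl (congrArg (x.ru k - ·) (net.rateU_sq x.ul k))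
  all_goals exact .inl rfl

theorem shortP_con_toPower_nonpos {x : ShortVars M N} (hx : ∀ m k, 0 ≤ x.dl m k)
    (hcon : ∀ i, (net.shortPAmp a).con i x ≤ 0) (i : ConIdx M N) :
    (net.shortP a).con i x.toPower ≤ 0 := by
  rcases net.shortP_con_toPower (a := a) hx i with h | ⟨m, k, rfl⟩ | ⟨k, rfl⟩
  · exact h.trans_le (hcon i)
  · exact neg_nonpos.2 (sq_nonneg (x.dl m k))
  · exact neg_nonpos.2 (sq_nonneg (x.ul k))

/-- At points where the original functions are differentiable, the Karush-Kuhn-Tucker conditions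
carry over from the amplitudes to the power control coefficients. -/
theorem isKKT_toPower {z : AlgVars M N} (hz : z ∈ net.feasible a)
    (hK : (net.shortPAmp a).IsKKT z.2) (hD : (net.shortP a).DiffAt z.2.toPower) :
    (net.shortP a).IsKKT z.2.toPower := by
  obtain ⟨hdom, hlin, hcon, c', g', lam, hc, hg, hlam, hslack, hstat⟩ := hK
  have hlin : z.2 ∈ noPower a := hlin
  have hv : ∀ m k, 0 ≤ z.2.dl m k := hz.2.2.2.2.2.2.2.1
  have hvpos : ∀ m k, a k ≠ 0 → 0 < z.2.dl m k := fun m k hk => net.dl_pos_of_diffAt hz hD hk m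
  have hupos : ∀ k, a k ≠ 0 → 0 < z.2.ul k := fun k hk => net.ul_pos_of_mem_feasible hz hk
  have hC := hD.1.hasFDerivWithinAt
  have hG := fun i => (hD.2 i).hasFDerivWithinAt
  -- Only the sign constraints change form under squaring. For selected users they are inactive, so
  -- their multipliers vanish; for the others both forms are zero on the subspace.
  have hlam0 : ∀ i, lam i = 0 ∨ ∀ y ∈ noPower a, (∀ m k, 0 ≤ y.dl m k) →
      (net.shortP a).con i y.toPower = (net.shortPAmp a).con i y := by
    intro i
    by_cases h : ∀ y ∈ noPower a, (∀ m k, 0 ≤ y.dl m k) →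
      (net.shortP a).con i y.toPower = (net.shortPAmp a).con i y
    · exact .inr h
    · left
      push Not at h
      obtain ⟨y, hy, hy0, hne⟩ := h
      rcases net.shortP_con_toPower (a := a) hy0 i with h | ⟨m, k, rfl⟩ | ⟨k, rfl⟩
      · exact absurd h hne
      · refine (mul_eq_zero.1 (hslack _)).resolve_right ?_
        refine (neg_lt_zero.2 (hvpos m k fun hk => hne ?_)).ne
        show -(y.dl m k ^ 2) = - y.dl m k
        rw [(hy k hk).1 m]; norm_num
      · refine (mul_eq_zero.1 (hslack _)).resolve_right ?_
        refine (neg_lt_zero.2 (hupos k fun hk => hne ?_)).ne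
        show -(y.ul k ^ 2) = - y.ul k
        rw [(hy k hk).2]; norm_num
  refine ⟨hdom, toPower_mem_noPower hlin, net.shortP_con_toPower_nonpos hv hcon, _, _, lam, hC, hG,
    hlam, fun i => ?_, fun d hd => ?_⟩
  · rcases hlam0 i with h | h
    · rw [h, zero_mul]
    · rw [h z.2 hlin hv]
      exact hslack i
  · have hd : d ∈ noPower a := hd
    -- The preimage of `d` under the differential of squaring. For users that are not selected the
    -- quotients are 0/0 = 0, as required.
    let e : ShortVars M N := (fun m k => d.dl m k / (2 * z.2.dl m k), d.f,
      fun k => d.ul k / (2 * z.2.ul k), d.rd, d.ru, d.td, d.tc, d.tu)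
    have he : e ∈ noPower a := fun k hk => ⟨fun m => by
      show d.dl m k / (2 * z.2.dl m k) = 0
      rw [(hd k hk).1 m, zero_div], by
      show d.ul k / (2 * z.2.ul k) = 0
      rw [(hd k hk).2, zero_div]⟩
    have hmem : ∀ t : ℝ, z.2 + t • e ∈ noPower a := fun t =>
      (noPower a).add_mem hlin ((noPower a).smul_mem t he)
    have hγ := hasDerivAt_toPower z.2 e
    have hγd : ((fun m k => 2 * z.2.dl m k * e.dl m k, e.f, fun k => 2 * z.2.ul k * e.ul k, e.rd,
        e.ru, e.td, e.tc, e.tu) : ShortVars M N) = d := by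
      refine Prod.ext (funext fun m => funext fun k => ?_)
        (Prod.ext rfl (Prod.ext (funext fun k => ?_) rfl))
      · show 2 * z.2.dl m k * (d.dl m k / (2 * z.2.dl m k)) = d.dl m k
        by_cases hk : a k = 0
        · rw [(hd k hk).1 m, zero_div, mul_zero]
        · exact mul_div_cancel₀ _ (mul_pos two_pos (hvpos m k hk)).ne'
      · show 2 * z.2.ul k * (d.ul k / (2 * z.2.ul k)) = d.ul k
        by_cases hk : a k = 0
        · rw [(hd k hk).2, zero_div, mul_zero]
        · exact mul_div_cancel₀ _ (mul_pos two_pos (hupos k hk)).ne'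
    rw [hγd] at hγ
    have hline := hasDerivAt_line z.2 e
    have hnonneg : ∀ᶠ t : ℝ in 𝓝 0, ∀ m k, 0 ≤ (z.2 + t • e).dl m k := by
      refine eventually_all.2 fun m => eventually_all.2 fun k => ?_
      by_cases hk : a k = 0
      · exact Eventually.of_forall fun t => ((hmem t k hk).1 m).ge
      · have hcont : Continuous fun t : ℝ => z.2.dl m k + t * e.dl m k := by fun_prop
        filter_upwards [hcont.continuousAt.eventually_const_lt
          (by simpa using hvpos m k hk : (0 : ℝ) < z.2.dl m k + 0 * e.dl m k)] with t ht
        exact ht.le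
    have hcost : fderivWithin ℝ (net.shortP a).cost (net.shortP a).lin z.2.toPower d = c' e :=
      (hC.hasDerivAt_curve hγ (by simp) fun t => toPower_mem_noPower (hmem t)).unique
        (hc.hasDerivAt_curve hline (by simp) hmem : HasDerivAt (fun t : ℝ => (z.2 + t • e).time) _ 0)
    rw [← hstat e he, hcost]
    refine congrArg (c' e + ·) (Finset.sum_congr rfl fun i _ => ?_)
    rcases hlam0 i with h | h
    · rw [h, zero_mul, zero_mul]
    · refine congrArg (lam i * ·) (HasDerivAt.unique
        ((hG i).hasDerivAt_curve hγ (by simp) fun t => toPower_mem_noPower (hmem t))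
        (((hg i).hasDerivAt_curve hline (by simp) hmem).congr_of_eventuallyEq ?_))
      filter_upwards [hnonneg] with t ht using h _ (hmem t) ht

/-! ### Cluster points of a run and convergence to the KKT set. -/

namespace IsRun

variable {net} {w : ℕ → AlgVars M N}

theorem mem_feasible_of_mapClusterPt (hw : net.IsRun a w) (hM : 0 < M)
    (ha : ∀ k, a k = 0 ∨ a k = 1) {z : AlgVars M N} (hz : MapClusterPt z atTop w) :
    z ∈ net.feasible a :=
  (net.isClosed_feasSet ha (fun k => (net.differentiable_rateDAmp k).continuous)
    (fun k => (net.differentiable_rateUAmp hM k).continuous)).mem_of_mapClusterPt hz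
    (Eventually.of_forall (hw.mem_feasible hM))

theorem isKKT_of_mapClusterPt (hw : net.IsRun a w) (hM : 0 < M)
    (ha : ∀ k, a k = 0 ∨ a k = 1) (hsel : ∃ k, a k = 1) {z : AlgVars M N}
    (hz : MapClusterPt z atTop w) : (net.shortPAmp a).IsKKT z.2 := by
  obtain ⟨T, hT⟩ := hw.exists_tendsto_time hM hsel
  have hzT : MapClusterPt z.2.time atTop fun n => (w n).2.time :=
    MapClusterPt.continuousAt_comp (f := fun y : AlgVars M N => y.2.time)
      continuous_time.continuousAt hz
  have hTz : z.2.time = T := by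
    by_contra hne
    obtain ⟨u, v, hu, hv, huz, hvT, huv⟩ := t2_separation hne
    obtain ⟨n, h1, h2⟩ := ((hzT.frequently (hu.mem_nhds huz)).and_eventually
      (hT.eventually (hv.mem_nhds hvT))).exists
    exact Set.disjoint_left.1 huv h1 h2
  refine net.isKKT_of_frequently hM ha (hw.mem_feasible_of_mapClusterPt hM ha hz)
    (frequently_iff.2 fun {U} hU => ?_)
  obtain ⟨n, hn⟩ := (mapClusterPt_iff_frequently.1 hz U hU).exists
  -- The limit value bounds the time of iterate `n + 1` from below, and that iterate is optimal for
  -- the problem anchored at iterate `n`.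
  refine ⟨w n, hn, hw.mem_feasible hM n, fun y hy => ?_⟩
  rw [hTz]
  exact ((hw.antitone_time hM).le_of_tendsto hT (n + 1)).trans ((hw.2 n).2 y hy)

end IsRun

end Network

/-- A sequence in a compact set approaches every set that contains its cluster points. -/
theorem IsCompact.tendsto_infDist_of_mapClusterPt {X : Type*} [PseudoMetricSpace X] {K S : Set X}
    (hK : IsCompact K) {w : ℕ → X} (hw : ∀ n, w n ∈ K)
    (hS : ∀ z, MapClusterPt z atTop w → z ∈ S) :
    Tendsto (fun n => Metric.infDist (w n) S) atTop (𝓝 0) := by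
  by_contra hcon
  obtain ⟨ε, hε, hfreq⟩ : ∃ ε > 0, ∃ᶠ n in atTop, ε ≤ Metric.infDist (w n) S := by
    by_contra! h
    refine hcon (Metric.tendsto_nhds.2 fun ε hε => ?_)
    filter_upwards [h ε hε] with n hn
    simpa [abs_of_nonneg Metric.infDist_nonneg] using hn
  obtain ⟨φ, hφ, hφε⟩ := extraction_of_frequently_atTop hfreq
  obtain ⟨z, -, ψ, hψ, hlim⟩ := hK.tendsto_subseq fun n => hw (φ n)
  have hz : z ∈ S := hS z <| MapClusterPt.of_comp
    (hφ.tendsto_atTop.comp hψ.tendsto_atTop) hlim.mapClusterPt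
  have h0 := (Metric.continuous_infDist_pt S).continuousAt.tendsto.comp hlim
  rw [Metric.infDist_zero_of_mem hz] at h0
  exact absurd (ge_of_tendsto' h0 fun n => hφε (ψ n)) (not_le.2 hε)

theorem proposition1 {M N : ℕ} (net : Network M N) (a : Fin N → ℝ)
    (ha : ∀ k, a k = 0 ∨ a k = 1) (hsel : ∃ k, a k = 1) :
    -- every approximate problem that the algorithm can meet has an optimal solution
    (∀ y ∈ net.feasible a, ∃ z, net.IsStep a y z) ∧
    -- convergence of every run of the algorithm
    ∀ w : ℕ → AlgVars M N, net.IsRun a w →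
      (∀ n, w n ∈ net.feasible a) ∧
      Antitone (fun n => (w n).2.time) ∧
      (∃ T : ℝ, Tendsto (fun n => (w n).2.time) atTop (𝓝 T)) ∧
      Bornology.IsBounded (Set.range w) ∧
      (∀ z : AlgVars M N, MapClusterPt z atTop w →
        z ∈ net.feasible a ∧
        (net.shortPAmp a).IsKKT z.2 ∧
        ((net.shortP a).DiffAt z.2.toPower → (net.shortP a).IsKKT z.2.toPower)) ∧
      Tendsto (fun n => Metric.infDist (w n)
        {z | z ∈ net.feasible a ∧ (net.shortPAmp a).IsKKT z.2}) atTop (𝓝 0) := by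
  refine ⟨fun y hy => net.exists_isStep ha hsel hy, fun w hw => ?_⟩
  have hM := net.pos_of_mem_feasible hsel hw.1
  have hK := net.isCompact_feasible_inter ha hsel hM (w 0).2.time
  have hwK := hw.mem_sublevel hM
  have hfeas := fun z => hw.mem_feasible_of_mapClusterPt hM ha (z := z)
  have hKKT := fun z => hw.isKKT_of_mapClusterPt hM ha hsel (z := z)
  -- The target set of the distance is nonempty, since a run stays in a compact set and so has a
  -- cluster point. The value 0 of `Metric.infDist` for the empty set plays no role.
  exact ⟨hw.mem_feasible hM, hw.antitone_time hM, hw.exists_tendsto_time hM hsel,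
    hK.isBounded.subset (Set.range_subset_iff.2 hwK),
    fun z hz => ⟨hfeas z hz, hKKT z hz, net.isKKT_toPower (hfeas z hz) (hKKT z hz)⟩,
    hK.tendsto_infDist_of_mapClusterPt hwK fun z hz => ⟨hfeas z hz, hKKT z hz⟩⟩
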